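/- **Setting.** Let $G$ be a topological groupoid with domain and range maps $d,r:G\to G_0$, where the space of units $G_0$ is regarded as a subspace of $G$. Assume that $G$ is étale ($d$ is a local homeomorphism) and that $G_0$ is locally compact Hausdorff. Then the topology $\mathcal O(G)$ is an involutive quantale with joins given by unions, product $UV=\{gh: g\in U,\ h\in V,\ d(g)=r(h)\}$ and involution $U\mapsto U^{-1}$. A *local bisection* is an open set $U\subset G$ on which $d$ and $r$ are injective; $\mathcal I(G)$ is the set of local bisections. A *Fell bundle* $\pi:E\to G$ is an upper semicontinuous Banach bundle over $G$. That is, $\pi$ is a continuous open surjection with Banach fibers $E_g=\pi^{-1}(g)$; $\pi^{-1}(U)$ is Hausdorff for every Hausdorff open $U\subset G$; addition $E\times_G E\to E$ and multiplication by each fixed complex scalar are continuous; the norm is upper semicontinuous on $E$; and for each $g\in G$ every neighborhood of $0_g$ contains a set $\{e:\pi(e)\in U,\ \|e\|<\varepsilon\}$ with $U\ni g$ open and $\varepsilon>0$. It is equipped with a continuous associative multiplication, defined on the pairs $(e,f)$ with $d(\pi(e))=r(\pi(f))$ and bilinear as a map $E_g\times E_h\to E_{gh}$, and with a continuous conjugate-linear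 involution $E_g\to E_{g^{-1}}$, such that $e^{**}=e$, $(ef)^*=f^*e^*$, $\|ef\|\le\|e\|\|f\|$, $\|e^*\|=\|e\|$, $\|e^*e\|=\|e\|^2$, and $e^*e\ge 0$ in the C*-algebra $E_{d(\pi(e))}$. It is *saturated* if for all composable $g,h$ the products $ef$ ($e\in E_g$, $f\in E_h$) span a dense subspace of $E_{gh}$; *abelian* if the C*-algebra $E_x$ is commutative for every $x\in G_0$; and a *Fell line bundle* if $\dim_{\mathbb C}E_g=1$ for every $g\in G$. For $U\in\mathcal I(G)$ let $C_c(U,E)$ be the space of sections of $\pi$ that are continuous on $U$ and vanish outside some compact subset of $U$. Let $S_c(G,E)$ be the linear span of all the spaces $C_c(U,E)$, $U\in\mathcal I(G)$; it is a $*$-algebra under the convolution $(st)(g)=\sum_{g=hk}s(h)t(k)$ and the involution $s^*(g)=s(g^{-1})^*$. A *compatible completion* $A$ is the completion of $S_c(G,E)$ in a C*-norm $\|\cdot\|$ such that $\|s\|_\infty\le\|s\|$ for all $s$, with equality if $s\in C_c(U,E)$ for some $U\in\mathcal I(G)$. For $g\in G$ let $\mathrm{eval}_g:A\to E_g$ be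 the continuous extension of $s\mapsto s(g)$. Let $\mathrm{Max}\,A$ be the involutive quantale of closed linear subspaces of $A$, ordered by inclusion, where $VW$ is the closed linear span of $\{ab:a\in V,\ b\in W\}$ and $V^*=\{a^*:a\in V\}$. Put $A|_U=\overline{C_c(U,E)}\in\mathrm{Max}\,A$ for $U\in\mathcal I(G)$, and, for $V\in\mathcal O(G)$, let $$p^*(V)=\bigvee\{A|_U: U\in\mathcal I(G),\ U\subset V\}.$$ Further put $\sigma(V)=\bigcup_{a\in V}\operatorname{int}\{g\in G:\mathrm{eval}_g(a)\ne 0\}$ for $V\in\mathrm{Max}\,A$, and let $\gamma(U)$, for $U\in\mathcal O(G)$, be the closed linear span of $\{a\in A:\sigma(\mathbb C a)\subset U\}$. The completion $A$ is *localizable* if $p^*=\gamma$. A *map* $p:Q\to\mathcal O(G)$ of involutive quantales is a homomorphism $p^*:\mathcal O(G)\to Q$ (preserving arbitrary joins, products and involutions). It is a *quantic bundle* if $p^*$ is injective, $p^*$ has a left adjoint $p_!$, and $p_!(a\,p^*(U)\,b)=p_!(a)\,U\,p_!(b)$ for all $U\in\mathcal O(G)$ and all $a,b\in Q$ with $p_!(a),p_!(b)\in\mathcal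 I(G)$. **Theorem.** Let $\pi:E\to G$ be a saturated Fell bundle over an étale groupoid $G$ with $G_0$ locally compact Hausdorff, and let $A$ be a localizable compatible completion. Then $p^*:\mathcal O(G)\to\mathrm{Max}\,A$ is a homomorphism of involutive quantales with $p^*(U)=A|_U$ for all $U\in\mathcal I(G)$, so that it defines a map $p:\mathrm{Max}\,A\to\mathcal O(G)$, and the following are equivalent: 1. $\pi$ is a Fell line bundle; 2. $\pi$ is abelian and $p$ is a quantic bundle. -/

import Mathlib

open TopologicalSpace Topology Filter

universe u v w

/-! ## Topological groupoids -/

/-- A topological groupoid, presented by its space `G` of arrows, with the space of units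
regarded as a subspace of `G`.  Only the values of `mul` on composable pairs
(`dom g = rng h`) are meaningful. -/
class TopologicalGroupoid (G : Type u) [TopologicalSpace G] where
  dom : G → G
  rng : G → G
  mul : G → G → G
  inv : G → G
  dom_dom : ∀ g, dom (dom g) = dom g
  rng_dom : ∀ g, rng (dom g) = dom g
  dom_rng : ∀ g, dom (rng g) = rng g
  rng_rng : ∀ g, rng (rng g) = rng g
  dom_mul : ∀ g h, dom g = rng h → dom (mul g h) = dom h
  rng_mul : ∀ g h, dom g = rng h → rng (mul g h) = rng g
  mul_assoc : ∀ g h k, dom g = rng h → dom h = rng k → mul (mul g h) k = mul g (mul h k)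
  mul_dom : ∀ g, mul g (dom g) = g
  rng_mul_self : ∀ g, mul (rng g) g = g
  dom_inv : ∀ g, dom (inv g) = rng g
  rng_inv : ∀ g, rng (inv g) = dom g
  inv_mul : ∀ g, mul (inv g) g = dom g
  mul_inv : ∀ g, mul g (inv g) = rng g
  continuous_dom : Continuous dom
  continuous_rng : Continuous rng
  continuous_inv : Continuous inv
  continuous_mul : ContinuousOn (fun q : G × G => mul q.1 q.2) {q | dom q.1 = rng q.2}

namespace TopologicalGroupoid

variable {G : Type u} [TopologicalSpace G] [TopologicalGroupoid G]

/-- `Comp g h k`: the pair `(g, h)` is composable and `g h = k`. -/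
def Comp (g h k : G) : Prop := dom g = rng h ∧ mul g h = k

variable (G) in
/-- The set of units `G₀`. -/
def units : Set G := {x | dom x = x}

/-- The domain map `d : G → G₀`. -/
def domU (g : G) : units G := ⟨dom g, dom_dom g⟩

theorem inv_inv (g : G) : inv (inv g) = g := by
  have h1 : mul (inv (inv g)) (mul (inv g) g) = inv (inv g) := by
    rw [inv_mul, ← rng_inv, ← dom_inv (inv g), mul_dom]
  have h2 : mul (mul (inv (inv g)) (inv g)) g = g := by
    rw [inv_mul, dom_inv, rng_mul_self]
  rw [← h1, ← mul_assoc _ _ _ (dom_inv _) (dom_inv _), h2]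

theorem mul_inv_cancel_right {g k : G} (h : dom g = dom k) : mul (mul g (inv k)) k = g := by
  rw [mul_assoc _ _ _ (by rw [rng_inv, h]) (dom_inv k), inv_mul, ← h, mul_dom]

theorem mul_inv_cancel_right' {g k : G} (h : dom g = rng k) : mul (mul g k) (inv k) = g := by
  rw [mul_assoc _ _ _ h (by rw [rng_inv]), mul_inv, ← h, mul_dom]

end TopologicalGroupoid

open TopologicalGroupoid (Comp units domU dom rng dom_dom rng_dom dom_rng rng_rng dom_mul rng_mul
  dom_inv rng_inv rng_mul_self)

/-- The standing conditions on groupoids: the domain map `d : G → G₀` is a local homeomorphism,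
and `G₀` is locally compact Hausdorff. -/
class IsEtaleGroupoid (G : Type u) [TopologicalSpace G] [TopologicalGroupoid G] : Prop where
  isLocalHomeomorph_dom : IsLocalHomeomorph (domU : G → units G)
  t2Space_units : T2Space (units G)
  locallyCompactSpace_units : LocallyCompactSpace (units G)

section Opens

variable {G : Type u} [TopologicalSpace G] [TopologicalGroupoid G]

/-- Local bisections: open sets on which both the domain and the range map are injective. -/
def IsLocalBisection (U : Opens G) : Prop :=
  Set.InjOn (dom : G → G) U ∧ Set.InjOn (rng : G → G) U

theorem tendsto_groupoid_mul {α : Type*} {l : Filter α} {a b : α → G} {g h : G}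
    (ha : Tendsto a l (𝓝 g)) (hb : Tendsto b l (𝓝 h)) (hgh : dom g = rng h)
    (hab : ∀ᶠ x in l, dom (a x) = rng (b x)) :
    Tendsto (fun x => TopologicalGroupoid.mul (a x) (b x)) l (𝓝 (TopologicalGroupoid.mul g h)) := by
  have h1 := TopologicalGroupoid.continuous_mul (G := G) (g, h) hgh
  exact h1.tendsto.comp (tendsto_nhdsWithin_iff.2 ⟨ha.prodMk_nhds hb, hab⟩)

/-- Near `dom k`, the local homeomorphism `dom` has a continuous section through `k`. -/
theorem exists_local_section [IsEtaleGroupoid G] (k : G) (V : Opens G) (hk : k ∈ V) (g : G)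
    (hg : dom g = dom k) : ∃ β : G → G, Tendsto β (𝓝 g) (𝓝 k) ∧
      ∀ᶠ g' in 𝓝 g, β g' ∈ V ∧ dom (β g') = dom g' := by
  obtain ⟨e, hke, he⟩ := IsEtaleGroupoid.isLocalHomeomorph_dom (G := G) k
  have hgk : domU g = domU k := Subtype.ext hg
  have hcd : Continuous (domU : G → units G) := TopologicalGroupoid.continuous_dom.subtype_mk _
  have htgt : domU g ∈ e.target := by
    rw [hgk, he]; exact e.map_source hke
  have hval : e.symm (domU g) = k := by
    rw [hgk, he]; exact e.left_inv hke
  have ht : Tendsto (fun g' => e.symm (domU g')) (𝓝 g) (𝓝 k) := by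
    have := (e.continuousAt_symm htgt).tendsto.comp (hcd.tendsto g)
    rwa [hval] at this
  refine ⟨fun g' => e.symm (domU g'), ht, ?_⟩
  filter_upwards [ht.eventually (V.isOpen.mem_nhds hk),
    (hcd.tendsto g).eventually (e.open_target.mem_nhds htgt)] with g' h1 h2
  refine ⟨h1, ?_⟩
  have h3 := e.right_inv h2
  rw [← he] at h3
  exact congrArg Subtype.val h3

theorem isOpen_groupoid_mul [IsEtaleGroupoid G] (U V : Opens G) :
    IsOpen {g : G | ∃ h ∈ U, ∃ k ∈ V, Comp h k g} := by
  rw [isOpen_iff_mem_nhds]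
  rintro g ⟨h, hU, k, hV, hc, rfl⟩
  obtain ⟨β, hβ, hβ'⟩ := exists_local_section k V hV (TopologicalGroupoid.mul h k) (dom_mul _ _ hc)
  have hinv : Tendsto (fun g' => TopologicalGroupoid.inv (β g'))
      (𝓝 (TopologicalGroupoid.mul h k)) (𝓝 (TopologicalGroupoid.inv k)) :=
    (TopologicalGroupoid.continuous_inv.tendsto k).comp hβ
  have hm : Tendsto (fun g' => TopologicalGroupoid.mul g' (TopologicalGroupoid.inv (β g')))
      (𝓝 (TopologicalGroupoid.mul h k)) (𝓝 h) := by
    have := tendsto_groupoid_mul tendsto_id hinv (by rw [dom_mul _ _ hc, rng_inv])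
      (hβ'.mono fun g' hg' => by rw [rng_inv, hg'.2, id])
    rwa [TopologicalGroupoid.mul_inv_cancel_right' hc] at this
  filter_upwards [hβ', hm.eventually (U.isOpen.mem_nhds hU)] with g' h1 h2
  exact ⟨_, h2, _, h1.1, by rw [dom_mul _ _ (by rw [rng_inv, h1.2]), dom_inv],
    TopologicalGroupoid.mul_inv_cancel_right h1.2.symm⟩

/-- The pointwise product `U V = {g h : g ∈ U, h ∈ V, (g, h) composable}` of the quantale of
open sets of an étale groupoid. -/
instance [IsEtaleGroupoid G] : Mul (Opens G) where
  mul U V := ⟨{g : G | ∃ h ∈ U, ∃ k ∈ V, Comp h k g}, isOpen_groupoid_mul U V⟩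

/-- The involution `U ↦ U⁻¹` of the quantale of open sets of a groupoid: `g ∈ U⁻¹` if and only if
`g⁻¹ ∈ U`. -/
instance : Star (Opens G) where
  star U := ⟨{g : G | TopologicalGroupoid.inv g ∈ U},
    U.isOpen.preimage TopologicalGroupoid.continuous_inv⟩

end Opens

/-! ## Maps of involutive quantales and quantic bundles

A map `p : Q → X` of involutive quantales is a homomorphism `p^* : X → Q`; it is represented here
by the function `p^*`. -/

/-- Homomorphisms of involutive quantales. -/
structure IsInvolutiveQuantaleHom {X Q : Type*} [CompleteLattice X] [Mul X] [Star X]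
    [CompleteLattice Q] [Mul Q] [Star Q] (f : X → Q) : Prop where
  map_sSup : ∀ S : Set X, f (sSup S) = sSup (f '' S)
  map_mul : ∀ a b, f (a * b) = f a * f b
  map_star : ∀ a, f (star a) = star (f a)

/-- The map `p : Q → 𝒪(G)` with inverse image `pStar` is a quantic bundle: it is a map of
involutive quantales, it is semiopen (`pStar` has a left adjoint `p_!`), it is surjective
(`pStar` is injective), and `p_!(a p^*(U) b) = p_!(a) U p_!(b)` whenever `p_!(a)` and `p_!(b)` are
local bisections. -/
def IsQuanticBundle {G : Type u} [TopologicalSpace G] [TopologicalGroupoid G] [IsEtaleGroupoid G]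
    {Q : Type*} [CompleteLattice Q] [Mul Q] [Star Q] (pStar : Opens G → Q) : Prop :=
  IsInvolutiveQuantaleHom pStar ∧ Function.Injective pStar ∧
    ∃ pLower : Q → Opens G, GaloisConnection pLower pStar ∧
      ∀ (U : Opens G) (a b : Q), IsLocalBisection (pLower a) → IsLocalBisection (pLower b) →
        pLower (a * pStar U * b) = pLower a * U * pLower b

/-! ## The spectrum `Max A` of a C*-algebra: the closed linear subspaces -/

section Max

variable {A : Type w} [NonUnitalCStarAlgebra A]

/-- The closed linear span of a set. -/
def closedSpan (S : Set A) : ClosedSubmodule ℂ A := (Submodule.span ℂ S).closure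

/-- `V W` is the closed linear span of the products `a b`, `a ∈ V`, `b ∈ W`. -/
instance : Mul (ClosedSubmodule ℂ A) where
  mul V W := closedSpan {c | ∃ a ∈ V, ∃ b ∈ W, a * b = c}

/-- The pointwise involution of closed subspaces: `a ∈ V^*` if and only if `a^* ∈ V`. -/
instance : Star (ClosedSubmodule ℂ A) where
  star V :=
    { carrier := {a | star a ∈ V}
      add_mem' := fun {a b} ha hb => by
        simp only [Set.mem_ofPred_eq, star_add] at *
        exact add_mem ha hb
      zero_mem' := by simp
      smul_mem' := fun c a ha => by
        simp only [Set.mem_ofPred_eq, star_smul] at *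
        exact SMulMemClass.smul_mem _ ha
      isClosed' := V.isClosed.preimage continuous_star }

end Max

/-! ## Banach bundles and Fell bundles -/

/-- The total space of a family of fibres.  Its topology is part of the data of a bundle. -/
structure Tot {G : Type u} (E : G → Type v) where
  base : G
  val : E base

/-- The fibre product `E ×_G E`. -/
structure FibrePair {G : Type u} (E : G → Type v) where
  base : G
  fst : E base
  snd : E base

instance {G : Type u} (E : G → Type v) [TopologicalSpace (Tot E)] :
    TopologicalSpace (FibrePair E) :=
  TopologicalSpace.induced (fun q => ((⟨q.base, q.fst⟩ : Tot E), (⟨q.base, q.snd⟩ : Tot E)))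
    inferInstance

/-- The space `E₂` of composable pairs of elements of the total space. -/
structure CompPair {G : Type u} [TopologicalSpace G] [TopologicalGroupoid G]
    (E : G → Type v) where
  left : G
  right : G
  comp : dom left = rng right
  fst : E left
  snd : E right

instance {G : Type u} [TopologicalSpace G] [TopologicalGroupoid G] (E : G → Type v)
    [TopologicalSpace (Tot E)] : TopologicalSpace (CompPair E) :=
  TopologicalSpace.induced (fun q => ((⟨q.left, q.fst⟩ : Tot E), (⟨q.right, q.snd⟩ : Tot E)))
    inferInstance

section Bundles

variable {G : Type u} [TopologicalSpace G]

/-- (Upper semicontinuous) Banach bundles over a space.  The fibres are Banach spaces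
(completeness of the fibres is an instance argument wherever it is used). -/
structure IsBanachBundle (E : G → Type v) [∀ g, NormedAddCommGroup (E g)]
    [∀ g, NormedSpace ℂ (E g)] [∀ g, CompleteSpace (E g)] [TopologicalSpace (Tot E)] : Prop where
  continuous_proj : Continuous (Tot.base : Tot E → G)
  isOpenMap_proj : IsOpenMap (Tot.base : Tot E → G)
  t2Space : ∀ U : Set G, IsOpen U → T2Space U → T2Space ((Tot.base : Tot E → G) ⁻¹' U)
  continuous_add : Continuous fun q : FibrePair E => (⟨q.base, q.fst + q.snd⟩ : Tot E)
  continuous_smul : ∀ c : ℂ, Continuous fun e : Tot E => (⟨e.base, c • e.val⟩ : Tot E)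
  upperSemicontinuous_norm : UpperSemicontinuous fun e : Tot E => ‖e.val‖
  tube : ∀ (x : G) (V : Set (Tot E)), IsOpen V → (⟨x, 0⟩ : Tot E) ∈ V →
    ∃ ε > (0 : ℝ), ∃ U : Set G, IsOpen U ∧ x ∈ U ∧
      ∀ e : Tot E, e.base ∈ U → ‖e.val‖ < ε → e ∈ V

variable [TopologicalGroupoid G]

/-- Fell bundles over a groupoid.  To avoid transports between fibres, the multiplication
`E_g × E_h → E_k` is indexed by a proof that `g h = k`, and the involution `E_g → E_k` by a proof
that `k = g⁻¹`. -/
structure FellBundle (E : G → Type v) [∀ g, NormedAddCommGroup (E g)]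
    [∀ g, NormedSpace ℂ (E g)] [∀ g, CompleteSpace (E g)] [TopologicalSpace (Tot E)] where
  isBanachBundle : IsBanachBundle E
  /-- multiplication -/
  mul : ∀ {g h k : G}, Comp g h k → E g →ₗ[ℂ] E h →ₗ[ℂ] E k
  /-- involution -/
  inv : ∀ {g k : G}, k = TopologicalGroupoid.inv g → E g →ₗ⋆[ℂ] E k
  continuous_mul : Continuous fun q : CompPair E =>
    (⟨TopologicalGroupoid.mul q.left q.right, mul ⟨q.comp, rfl⟩ q.fst q.snd⟩ : Tot E)
  continuous_inv : Continuous fun e : Tot E =>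
    (⟨TopologicalGroupoid.inv e.base, inv rfl e.val⟩ : Tot E)
  mul_assoc : ∀ {g₁ g₂ g₃ g₁₂ g₂₃ g : G} (c₁₂ : Comp g₁ g₂ g₁₂) (c₁₂' : Comp g₁₂ g₃ g)
    (c₂₃ : Comp g₂ g₃ g₂₃) (c₂₃' : Comp g₁ g₂₃ g) (e₁ : E g₁) (e₂ : E g₂) (e₃ : E g₃),
    mul c₁₂' (mul c₁₂ e₁ e₂) e₃ = mul c₂₃' e₁ (mul c₂₃ e₂ e₃)
  inv_inv : ∀ {g k : G} (hk : k = TopologicalGroupoid.inv g) (hg : g = TopologicalGroupoid.inv k)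
    (e : E g), inv hg (inv hk e) = e
  inv_mul : ∀ {g h k g' h' k' : G} (c : Comp g h k) (c' : Comp h' g' k')
    (hg : g' = TopologicalGroupoid.inv g) (hh : h' = TopologicalGroupoid.inv h)
    (hk : k' = TopologicalGroupoid.inv k) (e : E g) (f : E h),
    inv hk (mul c e f) = mul c' (inv hh f) (inv hg e)
  norm_mul_le : ∀ {g h k : G} (c : Comp g h k) (e : E g) (f : E h), ‖mul c e f‖ ≤ ‖e‖ * ‖f‖
  norm_inv : ∀ {g k : G} (hk : k = TopologicalGroupoid.inv g) (e : E g), ‖inv hk e‖ = ‖e‖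
  norm_inv_mul : ∀ {g x : G} (c : Comp (TopologicalGroupoid.inv g) g x) (e : E g),
    ‖mul c (inv rfl e) e‖ = ‖e‖ ^ 2
  /-- `e^* e` is a positive element of the C*-algebra `E_x`, where `x` is the unit `g⁻¹ g`;
  that is, it has the form `c^* c` with `c ∈ E_x`. -/
  inv_mul_nonneg : ∀ {g x : G} (c : Comp (TopologicalGroupoid.inv g) g x)
    (cx : Comp (TopologicalGroupoid.inv x) x x) (e : E g),
    ∃ b : E x, mul c (inv rfl e) e = mul cx (inv rfl b) b

end Bundles

namespace FellBundle

variable {G : Type u} [TopologicalSpace G] [TopologicalGroupoid G]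
  {E : G → Type v} [∀ g, NormedAddCommGroup (E g)] [∀ g, NormedSpace ℂ (E g)]
  [∀ g, CompleteSpace (E g)] [TopologicalSpace (Tot E)] (π : FellBundle E)

/-- The C*-algebra `E_x` is commutative for every unit `x`. -/
def IsAbelian : Prop :=
  ∀ (x : G) (c : Comp x x x) (e f : E x), π.mul c e f = π.mul c f e

/-- Saturation: `E_g E_h = E_{gh}`, where `E_g E_h` is the closed linear span of the products. -/
def IsSaturated : Prop :=
  ∀ (g h k : G) (c : Comp g h k),
    (Submodule.span ℂ {b : E k | ∃ e f, π.mul c e f = b}).topologicalClosure = ⊤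

/-- Fell line bundles: every fibre is one-dimensional. -/
def IsLineBundle (_π : FellBundle E) : Prop := ∀ g : G, Module.finrank ℂ (E g) = 1

/-- `C_c(U, E)`: the sections that are continuous on `U` and vanish outside some compact subset
of `U`. -/
def Cc (_π : FellBundle E) (U : Opens G) : Set (∀ g, E g) :=
  {s | ContinuousOn (fun g => (⟨g, s g⟩ : Tot E)) U ∧
    ∃ K : Set G, IsCompact K ∧ K ⊆ U ∧ ∀ g, s g ≠ 0 → g ∈ K}

/-- The space of compactly supported sections: the linear span of the union of the spaces
`C_c(U, E)` over all local bisections `U`. -/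
def sectionsC : Submodule ℂ (∀ g, E g) :=
  Submodule.span ℂ {s | ∃ U : Opens G, IsLocalBisection U ∧ s ∈ π.Cc U}

/-- The convolution `(s t)(g) = ∑_{g = h k} s(h) t(k)`. -/
noncomputable def conv (s t : ∀ g, E g) : ∀ g, E g := fun g =>
  ∑ᶠ q : {q : G × G // Comp q.1 q.2 g}, π.mul q.2 (s q.1.1) (t q.1.2)

/-- The involution `s^*(g) = s(g⁻¹)^*`. -/
def sectionInv (s : ∀ g, E g) : ∀ g, E g := fun g =>
  π.inv (TopologicalGroupoid.inv_inv g).symm (s (TopologicalGroupoid.inv g))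

theorem finite_support {s : ∀ g, E g} (hs : s ∈ π.sectionsC) (x : G) :
    {h : G | rng h = x ∧ s h ≠ 0}.Finite := by
  induction hs using Submodule.span_induction with
  | mem s hs =>
    obtain ⟨U, hU, -, K, -, hKU, hK⟩ := hs
    refine Set.Subsingleton.finite ?_
    rintro a ⟨ha, ha'⟩ b ⟨hb, hb'⟩
    exact hU.2 (hKU (hK _ ha')) (hKU (hK _ hb')) (ha.trans hb.symm)
  | zero => simp
  | add s t _ _ hs ht =>
    refine (hs.union ht).subset ?_
    rintro a ⟨ha, ha'⟩
    by_cases h : s a = 0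
    · right
      refine ⟨ha, fun h' => ha' ?_⟩
      simp [h, h']
    · exact Or.inl ⟨ha, h⟩
  | smul c s _ hs =>
    refine hs.subset ?_
    rintro a ⟨ha, ha'⟩
    refine ⟨ha, fun h => ha' ?_⟩
    simp [h]

theorem finite_support_conv {s : ∀ g, E g} (hs : s ∈ π.sectionsC) (t : ∀ g, E g) (g : G) :
    (Function.support fun q : {q : G × G // Comp q.1 q.2 g} =>
      π.mul q.2 (s q.1.1) (t q.1.2)).Finite := by
  have hinj : Function.Injective fun q : {q : G × G // Comp q.1 q.2 g} => q.1.1 := by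
    rintro ⟨⟨a, b⟩, hab, hg⟩ ⟨⟨a', b'⟩, hab', hg'⟩ (rfl : a = a')
    have key : ∀ b, dom a = rng b → TopologicalGroupoid.mul a b = g →
        b = TopologicalGroupoid.mul (TopologicalGroupoid.inv a) g := by
      rintro b hb rfl
      rw [← TopologicalGroupoid.mul_assoc _ _ _ (dom_inv a) hb, TopologicalGroupoid.inv_mul, hb,
        rng_mul_self]
    have : b = b' := (key b hab hg).trans (key b' hab' hg').symm
    subst this
    rfl
  refine ((π.finite_support hs (rng g)).preimage hinj.injOn).subset ?_
  rintro ⟨⟨a, b⟩, hab, hg⟩ hq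
  refine ⟨?_, fun h => hq ?_⟩
  · change rng a = rng g
    rw [← hg, rng_mul _ _ hab]
  · change π.mul _ (s a) (t b) = 0
    rw [show s a = 0 from h]
    simp

theorem conv_mem_Cc [IsEtaleGroupoid G] {U V : Opens G} (hU : IsLocalBisection U)
    (hV : IsLocalBisection V) {s t : ∀ g, E g} (hs : s ∈ π.Cc U) (ht : t ∈ π.Cc V) :
    π.conv s t ∈ π.Cc (U * V) := by
  obtain ⟨hsc, K, hK, hKU, hKs⟩ := hs
  obtain ⟨htc, L, hL, hLV, hLt⟩ := ht
  have hval : ∀ {g h k : G} (_ : h ∈ U) (_ : k ∈ V) (c : Comp h k g),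
      π.conv s t g = π.mul c (s h) (t k) := by
    intro g h k hh hk c
    refine finsum_eq_single _ (⟨(h, k), c⟩ : {q : G × G // Comp q.1 q.2 g}) ?_
    rintro ⟨⟨a, b⟩, hab, hg⟩ hne
    by_contra h0
    have ha : s a ≠ 0 := fun h => h0 (by change π.mul _ (s a) (t b) = 0; rw [h]; simp)
    have hb : t b ≠ 0 := fun h => h0 (by change π.mul _ (s a) (t b) = 0; rw [h]; simp)
    refine hne ?_
    have h1 : a = h := hU.2 (hKU (hKs _ ha)) hh (by
      rw [← rng_mul _ _ hab, ← rng_mul _ _ c.1]; exact congrArg rng (hg.trans c.2.symm))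
    have h2 : b = k := hV.1 (hLV (hLt _ hb)) hk (by
      rw [← dom_mul _ _ hab, ← dom_mul _ _ c.1]; exact congrArg dom (hg.trans c.2.symm))
    subst h1; subst h2; rfl
  refine ⟨?_, (fun q : G × G => TopologicalGroupoid.mul q.1 q.2) ''
    ((K ×ˢ L) ∩ {q | dom q.1 = rng q.2}), ?_, ?_, ?_⟩
  · rw [continuousOn_iff_continuous_domRestrict]
    have hex : ∀ g : ((U * V : Opens G) : Set G), ∃ h ∈ U, ∃ k ∈ V, Comp h k g.1 := fun g => g.2
    choose h hh k hk c using hex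
    have hkc : Continuous k := by
      rw [continuous_iff_continuousAt]
      intro g
      have hdom : ∀ g : ((U * V : Opens G) : Set G), dom (k g) = dom g.1 := fun g => by
        rw [← (c g).2, dom_mul _ _ (c g).1]
      obtain ⟨β, hβ, hβ'⟩ := exists_local_section (k g) V (hk g) g.1 (hdom g).symm
      have hval : Tendsto (Subtype.val : ((U * V : Opens G) : Set G) → G) (𝓝 g) (𝓝 g.1) :=
        continuous_subtype_val.tendsto g
      refine (hβ.comp hval).congr' ?_
      filter_upwards [hval.eventually hβ'] with g' hg'
      exact hV.1 hg'.1 (hk g') (hg'.2.trans (hdom g').symm)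
    have hheq : ∀ g, h g = TopologicalGroupoid.mul g.1 (TopologicalGroupoid.inv (k g)) := by
      intro g
      rw [← (c g).2, TopologicalGroupoid.mul_inv_cancel_right' (c g).1]
    have hhc : Continuous h := by
      rw [continuous_iff_continuousAt]
      intro g
      have hcomp : ∀ g : ((U * V : Opens G) : Set G),
          dom g.1 = rng (TopologicalGroupoid.inv (k g)) := fun g => by
        rw [rng_inv, ← (c g).2, dom_mul _ _ (c g).1]
      have := tendsto_groupoid_mul (continuous_subtype_val.tendsto g)
        ((TopologicalGroupoid.continuous_inv.comp hkc).tendsto g) (hcomp g)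
        (Eventually.of_forall hcomp)
      rw [Function.comp_apply, ← hheq g] at this
      exact this.congr fun g => (hheq g).symm
    have hsh : Continuous fun g => (⟨h g, s (h g)⟩ : Tot E) :=
      (continuousOn_iff_continuous_domRestrict.1 hsc).comp
        (hhc.subtype_mk (fun g => hh g) : Continuous fun g => (⟨h g, hh g⟩ : (U : Set G)))
    have htk : Continuous fun g => (⟨k g, t (k g)⟩ : Tot E) :=
      (continuousOn_iff_continuous_domRestrict.1 htc).comp
        (hkc.subtype_mk (fun g => hk g) : Continuous fun g => (⟨k g, hk g⟩ : (V : Set G)))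
    have hpair : Continuous fun g =>
        (⟨h g, k g, (c g).1, s (h g), t (k g)⟩ : CompPair E) :=
      continuous_induced_rng.2 (hsh.prodMk htk)
    refine (π.continuous_mul.comp hpair).congr fun g => ?_
    have hpt : ∀ (g' : G) (c' : Comp (h g) (k g) g'),
        (⟨TopologicalGroupoid.mul (h g) (k g), π.mul ⟨(c g).1, rfl⟩ (s (h g)) (t (k g))⟩ : Tot E) =
          ⟨g', π.mul c' (s (h g)) (t (k g))⟩ := by
      rintro g' ⟨h1, rfl⟩
      rfl
    have := hpt g.1 (c g)
    rw [← hval (hh g) (hk g) (c g)] at this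
    exact this
  · have ht2 : T2Space (units G) := IsEtaleGroupoid.t2Space_units
    have hcl : IsClosed {q : G × G | dom q.1 = rng q.2} := by
      have h1 : Continuous fun q : G × G => (⟨dom q.1, dom_dom q.1⟩ : units G) :=
        (TopologicalGroupoid.continuous_dom.comp continuous_fst).subtype_mk _
      have h2 : Continuous fun q : G × G => (⟨rng q.2, dom_rng q.2⟩ : units G) :=
        (TopologicalGroupoid.continuous_rng.comp continuous_snd).subtype_mk _
      simpa [Subtype.ext_iff] using isClosed_eq h1 h2
    exact ((hK.prod hL).inter_right hcl).image_of_continuousOn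
      (TopologicalGroupoid.continuous_mul.mono Set.inter_subset_right)
  · rintro _ ⟨⟨a, b⟩, ⟨⟨ha, hb⟩, hab⟩, rfl⟩
    exact ⟨a, hKU ha, b, hLV hb, hab, rfl⟩
  · intro g hg
    have hex : ∃ q : {q : G × G // Comp q.1 q.2 g}, π.mul q.2 (s q.1.1) (t q.1.2) ≠ 0 := by
      by_contra! h
      exact hg ((finsum_congr h).trans finsum_zero)
    obtain ⟨⟨⟨a, b⟩, hab, hab'⟩, hne⟩ := hex
    have ha : s a ≠ 0 := fun h => hne (by change π.mul _ (s a) (t b) = 0; rw [h]; simp)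
    have hb : t b ≠ 0 := fun h => hne (by change π.mul _ (s a) (t b) = 0; rw [h]; simp)
    exact ⟨(a, b), ⟨⟨hKs _ ha, hLt _ hb⟩, hab⟩, hab'⟩

theorem isLocalBisection_mul [IsEtaleGroupoid G] {U V : Opens G} (hU : IsLocalBisection U)
    (hV : IsLocalBisection V) : IsLocalBisection (U * V) := by
  constructor
  · rintro _ ⟨h, hh, k, hk, c, rfl⟩ _ ⟨h', hh', k', hk', c', rfl⟩ heq
    rw [dom_mul _ _ c, dom_mul _ _ c'] at heq
    obtain rfl := hV.1 hk hk' heq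
    rw [hU.1 hh hh' (c.trans c'.symm)]
  · rintro _ ⟨h, hh, k, hk, c, rfl⟩ _ ⟨h', hh', k', hk', c', rfl⟩ heq
    rw [rng_mul _ _ c, rng_mul _ _ c'] at heq
    obtain rfl := hU.2 hh hh' heq
    rw [hV.2 hk hk' (c.symm.trans c')]

theorem conv_mem [IsEtaleGroupoid G] {s t : ∀ g, E g} (hs : s ∈ π.sectionsC)
    (ht : t ∈ π.sectionsC) : π.conv s t ∈ π.sectionsC := by
  induction hs using Submodule.span_induction with
  | mem s hs =>
    obtain ⟨U, hU, hsU⟩ := hs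
    have hsm : s ∈ π.sectionsC := Submodule.subset_span ⟨U, hU, hsU⟩
    induction ht using Submodule.span_induction with
    | mem t ht =>
      obtain ⟨V, hV, htV⟩ := ht
      exact Submodule.subset_span ⟨U * V, isLocalBisection_mul hU hV, π.conv_mem_Cc hU hV hsU htV⟩
    | zero =>
      convert Submodule.zero_mem _
      ext g
      simp [conv]
    | add t t' _ _ h h' =>
      convert Submodule.add_mem _ h h'
      ext g
      simp only [conv, Pi.add_apply, map_add]
      exact finsum_add_distrib (π.finite_support_conv hsm _ g) (π.finite_support_conv hsm _ g)
    | smul z t _ h =>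
      convert Submodule.smul_mem _ z h
      ext g
      simp only [conv, Pi.smul_apply, map_smul]
      exact (smul_finsum z _).symm
  | zero =>
    convert Submodule.zero_mem _
    ext g
    simp [conv]
  | add s s' hs hs' h h' =>
    convert Submodule.add_mem _ h h'
    ext g
    simp only [conv, Pi.add_apply, map_add, LinearMap.add_apply]
    exact finsum_add_distrib (π.finite_support_conv hs _ g) (π.finite_support_conv hs' _ g)
  | smul z s _ h =>
    convert Submodule.smul_mem _ z h
    ext g
    simp only [conv, Pi.smul_apply, map_smul, LinearMap.smul_apply]
    exact (smul_finsum z _).symm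

theorem sectionInv_mem {s : ∀ g, E g} (hs : s ∈ π.sectionsC) :
    π.sectionInv s ∈ π.sectionsC := by
  induction hs using Submodule.span_induction with
  | mem s hs =>
    obtain ⟨U, hU, hsc, K, hK, hKU, hKs⟩ := hs
    refine Submodule.subset_span ⟨star U, ⟨?_, ?_⟩, ?_,
      TopologicalGroupoid.inv '' K, hK.image TopologicalGroupoid.continuous_inv, ?_, ?_⟩
    · intro a ha b hb hab
      rw [← TopologicalGroupoid.inv_inv a, ← TopologicalGroupoid.inv_inv b,
        hU.2 ha hb (by rw [rng_inv, rng_inv, hab])]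
    · intro a ha b hb hab
      rw [← TopologicalGroupoid.inv_inv a, ← TopologicalGroupoid.inv_inv b,
        hU.1 ha hb (by rw [dom_inv, dom_inv, hab])]
    · refine (π.continuous_inv.comp_continuousOn (hsc.comp
        TopologicalGroupoid.continuous_inv.continuousOn fun g hg => hg)).congr fun g _ => ?_
      have hpt : ∀ (g' : G) (hg' : g' = TopologicalGroupoid.inv (TopologicalGroupoid.inv g)),
          (⟨g', π.inv hg' (s (TopologicalGroupoid.inv g))⟩ : Tot E) =
            ⟨_, π.inv rfl (s (TopologicalGroupoid.inv g))⟩ := by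
        rintro _ rfl
        rfl
      exact hpt g (TopologicalGroupoid.inv_inv g).symm
    · rintro _ ⟨a, ha, rfl⟩
      change TopologicalGroupoid.inv (TopologicalGroupoid.inv a) ∈ U
      rw [TopologicalGroupoid.inv_inv]
      exact hKU ha
    · intro g hg
      refine ⟨TopologicalGroupoid.inv g, hKs _ fun h => hg ?_, TopologicalGroupoid.inv_inv g⟩
      simp [sectionInv, h]
  | zero =>
    convert Submodule.zero_mem _
    ext g
    simp [sectionInv]
  | add s s' _ _ h h' =>
    convert Submodule.add_mem _ h h'
    ext g
    simp [sectionInv]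
  | smul z s _ h =>
    convert Submodule.smul_mem _ (starRingEnd ℂ z) h
    ext g
    simp [sectionInv]

/-- The product of the convolution algebra. -/
noncomputable def convMul [IsEtaleGroupoid G] (s t : π.sectionsC) : π.sectionsC :=
  ⟨π.conv s t, π.conv_mem s.2 t.2⟩

/-- The involution of the convolution algebra. -/
def convStar (s : π.sectionsC) : π.sectionsC := ⟨π.sectionInv s, π.sectionInv_mem s.2⟩

/-- A compatible completion: a C*-algebra `A` with a dense copy of the convolution algebra, such
that the norm of `A` restricts to a compatible C*-norm, that is, it dominates the supremum norm and
coincides with it on sections compactly supported in a local bisection. -/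
structure CompatibleCompletion [IsEtaleGroupoid G] (A : Type w) [NonUnitalCStarAlgebra A] where
  toFun : π.sectionsC →ₗ[ℂ] A
  map_mul : ∀ s t, toFun (π.convMul s t) = toFun s * toFun t
  map_star : ∀ s, toFun (π.convStar s) = star (toFun s)
  denseRange : DenseRange toFun
  norm_apply_le : ∀ (s : π.sectionsC) (g : G), ‖(s : ∀ g, E g) g‖ ≤ ‖toFun s‖
  norm_eq : ∀ U : Opens G, IsLocalBisection U → ∀ s : π.sectionsC, (s : ∀ g, E g) ∈ π.Cc U →
    ‖toFun s‖ = ⨆ g, ‖(s : ∀ g, E g) g‖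

namespace CompatibleCompletion

variable {π} [IsEtaleGroupoid G] {A : Type w} [NonUnitalCStarAlgebra A]
  (ι : π.CompatibleCompletion A)

/-- The evaluation map `eval_g : A → E_g`, the continuous extension of `s ↦ s(g)`. -/
noncomputable def eval (g : G) : A →L[ℂ] E g :=
  ((LinearMap.proj g).comp π.sectionsC.subtype).extendOfNorm ι.toFun

/-- The restriction `A|_U`: the closure of `C_c(U, E)` in `A` (for `U` a local bisection). -/
noncomputable def restriction (U : Opens G) : ClosedSubmodule ℂ A :=
  closedSpan (ι.toFun '' {s | (s : ∀ g, E g) ∈ π.Cc U})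

/-- The inverse image `p^*` of the quantale map `p : Max A → 𝒪(G)` associated with `A`:
`p^*(V)` is the join of the restrictions `A|_U` over the local bisections `U ⊆ V`. -/
noncomputable def pStar (V : Opens G) : ClosedSubmodule ℂ A :=
  ⨆ U : {U : Opens G // IsLocalBisection U ∧ U ≤ V}, ι.restriction U

/-- `σ(V) = ⋃_{a ∈ V} int {g : eval_g(a) ≠ 0}`. -/
noncomputable def sigma (V : ClosedSubmodule ℂ A) : Opens G :=
  ⟨⋃ a ∈ V, interior {g | ι.eval g a ≠ 0}, isOpen_biUnion fun _ _ => isOpen_interior⟩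

/-- `γ(U)` is the closed linear span of `{a : σ(⟨a⟩) ⊆ U}`. -/
noncomputable def gamma (U : Opens G) : ClosedSubmodule ℂ A :=
  closedSpan {a | ι.sigma (closedSpan {a}) ≤ U}

/-- Localizability: `p^* = γ`. -/
def IsLocalizable : Prop := ι.pStar = ι.gamma

end CompatibleCompletion

end FellBundle

/-! The bundle is not assumed to have any continuous sections, `G` need not be Hausdorff, and the
norm is only upper semicontinuous. The technical base is therefore `exists_mem_Cc_apply_eq`: every
vector over a point of a local bisection `U` is the value of some section in `C_c(U, E)`. Such a
section is obtained from an arbitrary, approximately continuous choice of vectors by successive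
improvement with partitions of unity on `G₀`, pulled back along `d`; over a bisection this pullback
loses nothing, since `d` is injective there.

On one bisection the C*-norm is the supremum norm, so membership in a closed subspace is a local
question (`toFun_mem_of_locally`). This makes `p^*` preserve joins. For products, saturation
approximates `s(g)` by sums of products of vectors, these extend to sums of products of sections,
and upper semicontinuity of the norm keeps the error small near `g`. Localizability says precisely
that `σ` is left adjoint to `p^*`, so `σ` is the only candidate for `p_!`.

If `π` is a line bundle, products of nonzero vectors are nonzero. When `σ(a)` and `σ(b)` are
bisections, evaluating `α w β` at `h k l` gives the product of the three values, so it is nonzero on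
an open set; this yields `σ(a) U σ(b) ≤ σ(a p^*(U) b)`, and the other inclusion is adjointness.

Conversely, injectivity of `p^*` rules out zero fibres. If `e f = 0` in `E_x` with `e, f ≠ 0`, take
sections `s, t` through `e, f` over a bisection `V` containing `x`. Commutativity gives `e w f = w e
f = 0`, so all of `⟨s⟩ p^*(V) ⟨t⟩` vanishes at `x`, whereas `x = x x x` lies in `σ⟨s⟩ V σ⟨t⟩`. Hence
`E_x` has no zero divisors, and a nonzero C*-algebra of that kind is one-dimensional by functional
calculus. Saturation carries this from the units to all fibres. -/

/-! ## Upper semicontinuous Banach bundles -/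

namespace IsBanachBundle

variable {G : Type u} [TopologicalSpace G] {E : G → Type v} [∀ g, NormedAddCommGroup (E g)]
  [∀ g, NormedSpace ℂ (E g)] [∀ g, CompleteSpace (E g)] [TopologicalSpace (Tot E)]

section Tendsto

variable {α : Type*} {l : Filter α} {b : α → G} {x : G}

theorem tendsto_add (hE : IsBanachBundle E) {f f' : ∀ i, E (b i)} {e e' : E x}
    (hf : Tendsto (fun i => (⟨b i, f i⟩ : Tot E)) l (𝓝 ⟨x, e⟩))
    (hf' : Tendsto (fun i => (⟨b i, f' i⟩ : Tot E)) l (𝓝 ⟨x, e'⟩)) :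
    Tendsto (fun i => (⟨b i, f i + f' i⟩ : Tot E)) l (𝓝 ⟨x, e + e'⟩) := by
  have h : Tendsto (fun i => (⟨b i, f i, f' i⟩ : FibrePair E)) l (𝓝 ⟨x, e, e'⟩) := by
    rw [nhds_induced, tendsto_comap_iff]
    exact hf.prodMk_nhds hf'
  exact (hE.continuous_add.tendsto _).comp h

theorem tendsto_zero (hE : IsBanachBundle E) {f : ∀ i, E (b i)} (hb : Tendsto b l (𝓝 x))
    (hf : Tendsto (fun i => ‖f i‖) l (𝓝 0)) :
    Tendsto (fun i => (⟨b i, f i⟩ : Tot E)) l (𝓝 ⟨x, 0⟩) := by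
  rw [tendsto_nhds]
  intro V hV hxV
  obtain ⟨ε, hε, U, hU, hxU, h⟩ := hE.tube x V hV hxV
  filter_upwards [hb.eventually (hU.mem_nhds hxU), hf.eventually (gt_mem_nhds hε)] with i h1 h2
  exact h _ h1 h2

theorem tendsto_base (hE : IsBanachBundle E) {f : ∀ i, E (b i)} {e : E x}
    (hf : Tendsto (fun i => (⟨b i, f i⟩ : Tot E)) l (𝓝 ⟨x, e⟩)) : Tendsto b l (𝓝 x) :=
  (hE.continuous_proj.tendsto _).comp hf

theorem eventually_norm_lt (hE : IsBanachBundle E) {f : ∀ i, E (b i)} {e : E x}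
    (hf : Tendsto (fun i => (⟨b i, f i⟩ : Tot E)) l (𝓝 ⟨x, e⟩)) {r : ℝ} (hr : ‖e‖ < r) :
    ∀ᶠ i in l, ‖f i‖ < r :=
  hf.eventually (hE.upperSemicontinuous_norm ⟨x, e⟩ r hr)

/-- Joint continuity follows from continuity for each fixed scalar: in `c i • f i = z • f i + (c i -
z) • f i` the last term tends to zero, because upper semicontinuity bounds `‖f i‖` eventually by
`‖e‖ + 1`. -/
theorem tendsto_smul (hE : IsBanachBundle E) {f : ∀ i, E (b i)} {e : E x} {c : α → ℂ} {z : ℂ}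
    (hc : Tendsto c l (𝓝 z)) (hf : Tendsto (fun i => (⟨b i, f i⟩ : Tot E)) l (𝓝 ⟨x, e⟩)) :
    Tendsto (fun i => (⟨b i, c i • f i⟩ : Tot E)) l (𝓝 ⟨x, z • e⟩) := by
  have h1 : Tendsto (fun i => (⟨b i, z • f i⟩ : Tot E)) l (𝓝 ⟨x, z • e⟩) :=
    ((hE.continuous_smul z).tendsto _).comp hf
  have h2 : Tendsto (fun i => ‖(c i - z) • f i‖) l (𝓝 0) := by
    have h3 : Tendsto (fun i => ‖c i - z‖ * (‖e‖ + 1)) l (𝓝 0) := by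
      have : Tendsto (fun i => ‖c i - z‖) l (𝓝 0) := by
        simpa using (hc.sub_const z).norm
      simpa using this.mul_const (‖e‖ + 1)
    refine squeeze_zero' (Eventually.of_forall fun _ => norm_nonneg _) ?_ h3
    filter_upwards [hE.eventually_norm_lt hf (lt_add_one _)] with i hi
    rw [norm_smul]
    gcongr
  have h4 := hE.tendsto_add h1 (hE.tendsto_zero (hE.tendsto_base hf) h2)
  rw [add_zero] at h4
  refine h4.congr fun i => ?_
  rw [← add_smul, add_sub_cancel]

theorem tendsto_sub (hE : IsBanachBundle E) {f f' : ∀ i, E (b i)} {e e' : E x}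
    (hf : Tendsto (fun i => (⟨b i, f i⟩ : Tot E)) l (𝓝 ⟨x, e⟩))
    (hf' : Tendsto (fun i => (⟨b i, f' i⟩ : Tot E)) l (𝓝 ⟨x, e'⟩)) :
    Tendsto (fun i => (⟨b i, f i - f' i⟩ : Tot E)) l (𝓝 ⟨x, e - e'⟩) := by
  simpa [sub_eq_add_neg] using
    hE.tendsto_add hf (hE.tendsto_smul (tendsto_const_nhds (x := (-1 : ℂ))) hf')

end Tendsto

/-! ### Neighbourhoods in the total space. -/

theorem exists_nhds_add (hE : IsBanachBundle E) {x : G} {e e' : E x} {N : Set (Tot E)}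
    (hN : N ∈ 𝓝 (⟨x, e + e'⟩ : Tot E)) :
    ∃ N₁ ∈ 𝓝 (⟨x, e⟩ : Tot E), ∃ N₂ ∈ 𝓝 (⟨x, e'⟩ : Tot E), ∀ (z : G) (n m : E z),
      (⟨z, n⟩ : Tot E) ∈ N₁ → (⟨z, m⟩ : Tot E) ∈ N₂ → (⟨z, n + m⟩ : Tot E) ∈ N := by
  have h := (hE.continuous_add.tendsto ⟨x, e, e'⟩) hN
  rw [nhds_induced, Filter.mem_map, mem_comap] at h
  obtain ⟨t, ht, hts⟩ := h
  obtain ⟨N₁, h₁, N₂, h₂, h⟩ := mem_nhds_prod_iff.1 ht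
  exact ⟨N₁, h₁, N₂, h₂, fun z n m hn hm => hts (a := ⟨z, n, m⟩) (h ⟨hn, hm⟩)⟩

theorem exists_nhds_smul (hE : IsBanachBundle E) {x : G} {c : ℂ} {e : E x} {N : Set (Tot E)}
    (hN : N ∈ 𝓝 (⟨x, c • e⟩ : Tot E)) :
    ∃ C ∈ 𝓝 c, ∃ N₁ ∈ 𝓝 (⟨x, e⟩ : Tot E), ∀ (z : G) (c' : ℂ) (n : E z),
      c' ∈ C → (⟨z, n⟩ : Tot E) ∈ N₁ → (⟨z, c' • n⟩ : Tot E) ∈ N := by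
  have h1 : Tendsto (fun q : ℂ × Tot E => (⟨q.2.base, q.1 • q.2.val⟩ : Tot E))
      (𝓝 c ×ˢ 𝓝 ⟨x, e⟩) (𝓝 ⟨x, c • e⟩) := hE.tendsto_smul tendsto_fst tendsto_snd
  obtain ⟨C, hC, N₁, h₁, h⟩ := mem_prod_iff.1 (h1 hN)
  exact ⟨C, hC, N₁, h₁, fun z c' n hc hn => h (Set.mk_mem_prod hc hn)⟩

/-- Every point of the total space has a neighbourhood whose intersection with each fibre has
small diameter. -/
theorem exists_thin_nhds (hE : IsBanachBundle E) {x : G} (e : E x) {δ : ℝ} (hδ : 0 < δ) :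
    ∃ W : Set (Tot E), IsOpen W ∧ (⟨x, e⟩ : Tot E) ∈ W ∧ ∀ (z : G) (n m : E z),
      (⟨z, n⟩ : Tot E) ∈ W → (⟨z, m⟩ : Tot E) ∈ W → ‖n - m‖ < δ := by
  have h0 : {q : Tot E | ‖q.val‖ < δ} ∈ 𝓝 (⟨x, e + (-1 : ℂ) • e⟩ : Tot E) :=
    hE.upperSemicontinuous_norm _ δ (by simpa using hδ)
  obtain ⟨N₁, h₁, N₂, h₂, h⟩ := hE.exists_nhds_add h0
  have h₃ := ((hE.continuous_smul (-1)).tendsto (⟨x, e⟩ : Tot E)) h₂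
  obtain ⟨W, hW, hWo, heW⟩ := mem_nhds_iff.1 (inter_mem h₁ h₃)
  refine ⟨W, hWo, heW, fun z n m hn hm => ?_⟩
  simpa [sub_eq_add_neg] using h z n ((-1 : ℂ) • m) (hW hn).1 (hW hm).2

/-- Openness of the projection, in a form that stands in for local sections until these have been
constructed. -/
theorem eventually_exists_mem (hE : IsBanachBundle E) {x : G} {e : E x} {N : Set (Tot E)}
    (hN : N ∈ 𝓝 (⟨x, e⟩ : Tot E)) : ∀ᶠ z in 𝓝 x, ∃ n : E z, (⟨z, n⟩ : Tot E) ∈ N := by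
  filter_upwards [hE.isOpenMap_proj.image_mem_nhds hN]
  rintro _ ⟨q, hq, rfl⟩
  exact ⟨q.val, hq⟩

theorem continuous_zero (hE : IsBanachBundle E) : Continuous fun z : G => (⟨z, 0⟩ : Tot E) :=
  continuous_iff_continuousAt.2 fun _ => hE.tendsto_zero tendsto_id (by simp)

/-! ### Approximately continuous sections -/

/-- A section is continuous at `y` within `K` up to an error bounded by `r`. -/
def ApproxContinuousWithinAt (s : ∀ g, E g) (r : G → ℝ) (K : Set G) (y : G) : Prop :=
  ∀ N ∈ 𝓝 (⟨y, s y⟩ : Tot E), ∀ᶠ z in 𝓝[K] y, ∃ n : E z, (⟨z, n⟩ : Tot E) ∈ N ∧ ‖s z - n‖ ≤ r z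

theorem ApproxContinuousWithinAt.add (hE : IsBanachBundle E) {s t : ∀ g, E g} {r r' : G → ℝ}
    {K : Set G} {y : G} (hs : ApproxContinuousWithinAt s r K y)
    (ht : ApproxContinuousWithinAt t r' K y) :
    ApproxContinuousWithinAt (fun z => s z + t z) (fun z => r z + r' z) K y := by
  intro N hN
  obtain ⟨N₁, h₁, N₂, h₂, h⟩ := hE.exists_nhds_add hN
  filter_upwards [hs N₁ h₁, ht N₂ h₂]
  rintro z ⟨n, hn, hn'⟩ ⟨m, hm, hm'⟩
  refine ⟨n + m, h z n m hn hm, ?_⟩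
  rw [add_sub_add_comm]
  exact (norm_add_le _ _).trans (add_le_add hn' hm')

theorem ApproxContinuousWithinAt.smul (hE : IsBanachBundle E) {s : ∀ g, E g} {r : G → ℝ}
    {K : Set G} {y : G} (hs : ApproxContinuousWithinAt s r K y) {φ : G → ℝ} (hφ : Continuous φ)
    (hφ0 : ∀ z, 0 ≤ φ z) :
    ApproxContinuousWithinAt (fun z => (φ z : ℂ) • s z) (fun z => φ z * r z) K y := by
  intro N hN
  obtain ⟨C, hC, N₁, h₁, h⟩ := hE.exists_nhds_smul hN
  have hφ' : ∀ᶠ z in 𝓝[K] y, (φ z : ℂ) ∈ C :=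
    ((Complex.continuous_ofReal.comp hφ).tendsto y).mono_left nhdsWithin_le_nhds hC
  filter_upwards [hs N₁ h₁, hφ']
  rintro z ⟨n, hn, hn'⟩ hz
  refine ⟨(φ z : ℂ) • n, h z _ n hz hn, ?_⟩
  rw [← smul_sub, norm_smul, Complex.norm_real, Real.norm_of_nonneg (hφ0 z)]
  exact mul_le_mul_of_nonneg_left hn' (hφ0 z)

theorem approxContinuousWithinAt_of_eventually_eq_zero (hE : IsBanachBundle E) {s : ∀ g, E g}
    {r : G → ℝ} {K : Set G} {y : G} (hs : ∀ᶠ z in 𝓝 y, s z = 0) (hr : ∀ z, 0 ≤ r z) :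
    ApproxContinuousWithinAt s r K y := by
  intro N hN
  rw [hs.self_of_nhds] at hN
  filter_upwards [nhdsWithin_le_nhds hs, nhdsWithin_le_nhds ((hE.continuous_zero.tendsto y) hN)]
    with z h1 h2
  exact ⟨0, h2, by simp [h1, hr z]⟩

theorem approxContinuousWithinAt_sum (hE : IsBanachBundle E) {ι : Type*} (F : Finset ι)
    {s : ι → ∀ g, E g} {r : ι → G → ℝ} {K : Set G} {y : G}
    (hs : ∀ i ∈ F, ApproxContinuousWithinAt (s i) (r i) K y) :
    ApproxContinuousWithinAt (fun z => ∑ i ∈ F, s i z) (fun z => ∑ i ∈ F, r i z) K y := by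
  classical
  induction F using Finset.induction_on with
  | empty =>
    exact hE.approxContinuousWithinAt_of_eventually_eq_zero (by simp) (by simp)
  | insert i F hi ih =>
    simp only [Finset.sum_insert hi]
    exact (hs i (Finset.mem_insert_self i F)).add hE
      (ih fun j hj => hs j (Finset.mem_insert_of_mem hj))

/-- A choice of points in a thin open set is approximately continuous. -/
theorem approxContinuousWithinAt_of_thin (hE : IsBanachBundle E) {s : ∀ g, E g} {δ : ℝ}
    {W : Set (Tot E)} (hW : IsOpen W)
    (hthin : ∀ (z : G) (n m : E z), (⟨z, n⟩ : Tot E) ∈ W → (⟨z, m⟩ : Tot E) ∈ W → ‖n - m‖ < δ)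
    (hs : ∀ z ∈ Tot.base '' W, (⟨z, s z⟩ : Tot E) ∈ W) (K : Set G) {y : G}
    (hy : y ∈ Tot.base '' W) : ApproxContinuousWithinAt s (fun _ => δ) K y := by
  intro N hN
  filter_upwards [nhdsWithin_le_nhds
    (hE.eventually_exists_mem (inter_mem hN (hW.mem_nhds (hs y hy))))]
  rintro z ⟨n, hn, hn'⟩
  exact ⟨n, hn, (hthin z _ _ (hs z ⟨_, hn', rfl⟩) hn').le⟩

/-- A uniform limit of approximately continuous sections, with errors tending to zero, is
continuous. -/
theorem continuousWithinAt_of_approx (hE : IsBanachBundle E) {s : ∀ g, E g} {K : Set G} {y : G}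
    (hy : y ∈ K)
    (h : ∀ η > 0, ∃ t : ∀ g, E g, ApproxContinuousWithinAt t (fun _ => η) K y ∧
      ∀ z ∈ K, ‖s z - t z‖ < η) :
    ContinuousWithinAt (fun z => (⟨z, s z⟩ : Tot E)) K y := by
  intro N hN
  obtain ⟨N₁, h₁, N₂, h₂, hN'⟩ := hE.exists_nhds_add (e := s y) (e' := 0) (by simpa using hN)
  obtain ⟨V, hV, hVo, hyV⟩ := mem_nhds_iff.1 h₂
  obtain ⟨ε, hε, U, hU, hyU, htube⟩ := hE.tube y V hVo hyV
  obtain ⟨t, ht, hst⟩ := h (ε / 3) (by positivity)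
  have hsy : t y + (s y - t y) = s y := by abel
  obtain ⟨N₃, h₃, N₄, h₄, hN₁⟩ :=
    hE.exists_nhds_add (e := t y) (e' := s y - t y) (by rw [hsy]; exact h₁)
  have h₅ : {q : Tot E | ‖q.val‖ < ε / 3} ∈ 𝓝 (⟨y, s y - t y⟩ : Tot E) :=
    hE.upperSemicontinuous_norm _ _ (hst y hy)
  rw [Filter.mem_map]
  filter_upwards [ht N₃ h₃, nhdsWithin_le_nhds (hE.eventually_exists_mem (inter_mem h₄ h₅)),
    self_mem_nhdsWithin, nhdsWithin_le_nhds (hU.mem_nhds hyU)]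
  rintro z ⟨n, hn, hn'⟩ ⟨m, hm, hm'⟩ hz hzU
  -- Here `n` is close to `t z` and `m` is a short vector near `s y - t y`, so `n + m` is near `s
  -- y`. The remainder `s z - (n + m)` consists of three terms, with total norm below `ε`, and falls
  -- into the tube around zero.
  have h6 := hN' z (n + m) (s z - (n + m)) (hN₁ z n m hn hm) (hV (htube _ hzU (by
    have : s z - (n + m) = (s z - t z) + (t z - n) - m := by abel
    rw [this]
    have h7 : ‖m‖ < ε / 3 := hm'
    calc _ ≤ ‖s z - t z‖ + ‖t z - n‖ + ‖m‖ :=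
          (norm_sub_le _ _).trans (by gcongr; exact norm_add_le _ _)
      _ < ε := by linarith [hst z hz])))
  simpa using h6

end IsBanachBundle

/-! ## Étale groupoids -/

/-- The functions are indexed by all of `ι` and set to zero off `F`, which avoids subtypes in the
sums. The bound by one off `L` is what keeps glued errors uniform. -/
theorem exists_partition_of_unity {X : Type*} [TopologicalSpace X] [T2Space X]
    [LocallyCompactSpace X] {L : Set X} (hL : IsCompact L) {ι : Type*} (O : ι → Set X)
    (hO : ∀ i, IsOpen (O i)) (hLO : L ⊆ ⋃ i, O i) :
    ∃ (F : Finset ι) (φ : ι → C(X, ℝ)), (∀ i ∈ F, tsupport (φ i) ⊆ O i) ∧ (∀ i x, 0 ≤ φ i x) ∧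
      (∀ x, ∑ i ∈ F, φ i x ≤ 1) ∧ ∀ x ∈ L, ∑ i ∈ F, φ i x = 1 := by
  classical
  obtain ⟨F, hF⟩ := hL.elim_finite_subcover O hO hLO
  obtain ⟨f, hf, -⟩ := PartitionOfUnity.exists_isSubordinate_of_locallyFinite_t2space hL
    (fun i : F => O i) (fun i => hO i) (locallyFinite_of_finite _) (by
      intro x hx
      obtain ⟨i, hi, hxi⟩ := Set.mem_iUnion₂.1 (hF hx)
      exact Set.mem_iUnion.2 ⟨⟨i, hi⟩, hxi⟩)
  have hsum : ∀ x, ∑ i ∈ F, (if h : i ∈ F then f ⟨i, h⟩ else 0 : C(X, ℝ)) x = ∑ᶠ i, f i x := by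
    intro x
    rw [finsum_eq_sum_of_fintype, ← Finset.sum_coe_sort F]
    exact Finset.sum_congr rfl fun i _ => by simp
  refine ⟨F, fun i => if h : i ∈ F then f ⟨i, h⟩ else 0, ?_, ?_, ?_, ?_⟩
  · intro i hi
    simp only [hi, dite_true]
    exact hf ⟨i, hi⟩
  · intro i x
    dsimp only
    split_ifs with h
    · exact f.nonneg _ _
    · simp
  · intro x
    rw [hsum]
    exact f.sum_le_one x
  · intro x hx
    rw [hsum]
    exact f.sum_eq_one hx

section Etale

variable {G : Type u} [TopologicalSpace G] [TopologicalGroupoid G]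

theorem continuous_domU : Continuous (domU : G → units G) :=
  TopologicalGroupoid.continuous_dom.subtype_mk _

theorem injOn_domU {U : Opens G} (hU : IsLocalBisection U) :
    Set.InjOn (domU : G → units G) U :=
  fun _ ha _ hb h => hU.1 ha hb (congrArg Subtype.val h)

theorem IsLocalBisection.mono {U V : Opens G} (hV : IsLocalBisection V) (h : U ≤ V) :
    IsLocalBisection U :=
  ⟨hV.1.mono h, hV.2.mono h⟩

/-- Injectivity of `d` on `U` lets supports of functions on `G₀` be read back as subsets of `U`. -/
theorem mem_of_domU_mem_image {U : Opens G} (hU : IsLocalBisection U) {N : Set G}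
    (hN : N ⊆ U) {z : G} (hz : z ∈ U) (h : domU z ∈ (domU : G → units G) '' N) : z ∈ N := by
  obtain ⟨n, hn, hnz⟩ := h
  rwa [← injOn_domU hU (hN hn) hz hnz]

variable [IsEtaleGroupoid G]

theorem isOpenMap_domU : IsOpenMap (domU : G → units G) :=
  IsEtaleGroupoid.isLocalHomeomorph_dom.isOpenMap

theorem opens_mul_mono {U U' V V' : Opens G} (hU : U ≤ U') (hV : V ≤ V') : U * V ≤ U' * V' := by
  rintro g ⟨h, hh, k, hk, c⟩
  exact ⟨h, hU hh, k, hV hk, c⟩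

/-- A compact `K` need not be closed in the possibly non-Hausdorff `G`, but `d(K)` is closed in
`G₀`, and inside `U` the set `K` is the preimage of `d(K)`. -/
theorem isOpen_diff_of_isCompact {U : Opens G} (hU : IsLocalBisection U) {K : Set G}
    (hK : IsCompact K) (hKU : K ⊆ U) : IsOpen ((U : Set G) \ K) := by
  have : T2Space (units G) := IsEtaleGroupoid.t2Space_units
  have h : (U : Set G) \ K = (U : Set G) ∩ domU ⁻¹' ((domU : G → units G) '' K)ᶜ := by
    ext z
    refine ⟨fun hz => ⟨hz.1, fun h => hz.2 (mem_of_domU_mem_image hU hKU hz.1 h)⟩,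
      fun hz => ⟨hz.1, fun h => hz.2 ⟨z, h, rfl⟩⟩⟩
  rw [h]
  exact U.isOpen.inter ((hK.image continuous_domU).isClosed.isOpen_compl.preimage continuous_domU)

theorem t2Space_of_isLocalBisection {U : Opens G} (hU : IsLocalBisection U) :
    T2Space (U : Set G) := by
  have : T2Space (units G) := IsEtaleGroupoid.t2Space_units
  exact T2Space.of_injective_continuous (f := fun z : (U : Set G) => domU z.1)
    (fun a b h => Subtype.ext (injOn_domU hU a.2 b.2 h))
    (continuous_domU.comp continuous_subtype_val)

/-- The local homeomorphism `d` is injective near `g` and near `g⁻¹`; inverting the second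
neighbourhood gives one on which `r` is injective. -/
theorem exists_isLocalBisection_mem (V : Opens G) {g : G} (hg : g ∈ V) :
    ∃ U : Opens G, IsLocalBisection U ∧ g ∈ U ∧ U ≤ V := by
  have key : ∀ k : G, ∃ W : Opens G, k ∈ W ∧ Set.InjOn (dom : G → G) W := by
    intro k
    obtain ⟨e, hke, he⟩ := IsEtaleGroupoid.isLocalHomeomorph_dom (G := G) k
    refine ⟨⟨e.source, e.open_source⟩, hke, fun a ha b hb h => e.injOn ha hb ?_⟩
    rw [← he]
    exact Subtype.ext h
  obtain ⟨W, hgW, hW⟩ := key g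
  obtain ⟨W', hgW', hW'⟩ := key (TopologicalGroupoid.inv g)
  refine ⟨V ⊓ W ⊓ star W', ⟨?_, ?_⟩, ⟨⟨hg, hgW⟩, hgW'⟩, inf_le_left.trans inf_le_left⟩
  · exact hW.mono fun z hz => hz.1.2
  · intro a ha b hb h
    rw [← TopologicalGroupoid.inv_inv a, ← TopologicalGroupoid.inv_inv b,
      hW' ha.2 hb.2 (by rw [dom_inv, dom_inv, h])]

end Etale

/-! ## Existence of sections -/

section ExistsSection

variable {G : Type u} [TopologicalSpace G] [TopologicalGroupoid G] [IsEtaleGroupoid G]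
  {E : G → Type v} [∀ g, NormedAddCommGroup (E g)] [∀ g, NormedSpace ℂ (E g)]
  [∀ g, CompleteSpace (E g)] [TopologicalSpace (Tot E)]

namespace IsBanachBundle

/-- A section that is continuous up to `ε` can be replaced by a nearby section that is continuous
up to a given smaller error. -/
theorem exists_approx_refinement (hE : IsBanachBundle E) {U : Opens G} (hU : IsLocalBisection U)
    {K : Set G} (hK : IsCompact K) (hKU : K ⊆ U) {g : G} (hg : g ∈ K) {s : ∀ g, E g} {ε δ : ℝ}
    (hδ : 0 < δ) (hs : ∀ y ∈ K, ApproxContinuousWithinAt s (fun _ => ε) K y) :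
    ∃ s' : ∀ g, E g, s' g = s g ∧ (∀ y ∈ K, ApproxContinuousWithinAt s' (fun _ => δ) K y) ∧
      ∀ y ∈ K, ‖s' y - s y‖ ≤ ε + δ := by
  classical
  have : T2Space (units G) := IsEtaleGroupoid.t2Space_units
  have : LocallyCompactSpace (units G) := IsEtaleGroupoid.locallyCompactSpace_units
  have key : ∀ y : K, ∃ (t : ∀ z, E z) (N : Set G), IsOpen N ∧ y.1 ∈ N ∧ N ⊆ U ∧
      (g ∈ N → t g = s g) ∧ (∀ z ∈ N, ApproxContinuousWithinAt t (fun _ => δ) K z) ∧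
      ∀ z ∈ N, z ∈ K → ‖t z - s z‖ ≤ ε + δ := by
    rintro ⟨y, hy⟩
    obtain ⟨W, hW, hyW, hthin⟩ := hE.exists_thin_nhds (s y) hδ
    obtain ⟨O, hO, hyO, hOK⟩ := mem_nhdsWithin.1 (hs y hy W (hW.mem_nhds hyW))
    -- Only the patch centred at `g` may contain `g`; there the local choice is forced to be `s g`,
    -- so gluing does not change the value at `g`.
    obtain ⟨M, hM, hyM, hMU, hMg⟩ : ∃ M : Set G, IsOpen M ∧ y ∈ M ∧ M ⊆ U ∧ (g ∈ M → g = y) := by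
      by_cases h : g = y
      · exact ⟨U, U.isOpen, hKU hy, subset_rfl, fun _ => h⟩
      · exact ⟨U \ {g}, isOpen_diff_of_isCompact hU isCompact_singleton (by simpa using hKU hg),
          ⟨hKU hy, fun h' => h (Eq.symm h')⟩, Set.sdiff_subset, fun h' => absurd rfl h'.2⟩
    have hex : ∀ z, ∃ n : E z, z ∈ Tot.base '' W → (⟨z, n⟩ : Tot E) ∈ W := by
      intro z
      by_cases h : z ∈ Tot.base '' W
      · obtain ⟨q, hq, rfl⟩ := h
        exact ⟨q.val, fun _ => hq⟩
      · exact ⟨0, fun h' => absurd h' h⟩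
    choose t₀ ht₀ using hex
    have ht : ∀ z ∈ Tot.base '' W, (⟨z, Function.update t₀ y (s y) z⟩ : Tot E) ∈ W := by
      intro z hz
      by_cases h : z = y
      · subst h
        simpa using hyW
      · rw [Function.update_of_ne h]
        exact ht₀ z hz
    refine ⟨Function.update t₀ y (s y), O ∩ M ∩ Tot.base '' W,
      (hO.inter hM).inter (hE.isOpenMap_proj W hW), ⟨⟨hyO, hyM⟩, _, hyW, rfl⟩,
      fun z hz => hMU hz.1.2, ?_, ?_, ?_⟩
    · intro hgN
      obtain rfl := hMg hgN.1.2
      simp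
    · exact fun z hz => hE.approxContinuousWithinAt_of_thin hW hthin ht K hz.2
    · intro z hz hzK
      obtain ⟨n, hn, hn'⟩ := hOK ⟨hz.1.1, hzK⟩
      have h1 := hthin z _ n (ht z hz.2) hn
      calc _ = ‖(Function.update t₀ y (s y) z - n) - (s z - n)‖ := by congr 1; abel
        _ ≤ _ := (norm_sub_le _ _).trans (by linarith)
  choose t N hNo hyN hNU htg htc hts using key
  -- The local choices are glued by convex combinations, which preserve the error `δ` and the
  -- distance `ε + δ` to `s`.
  obtain ⟨F, φ, hφN, hφ0, hφ1, hφK⟩ := exists_partition_of_unity (hK.image continuous_domU)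
    (fun y => (domU : G → units G) '' N y) (fun y => isOpenMap_domU _ (hNo y)) (by
      rintro _ ⟨y, hy, rfl⟩
      exact Set.mem_iUnion.2 ⟨⟨y, hy⟩, _, hyN ⟨y, hy⟩, rfl⟩)
  have hmem : ∀ i ∈ F, ∀ z ∈ K, domU z ∈ tsupport (φ i) → z ∈ N i := fun i hi z hz h =>
    mem_of_domU_mem_image hU (hNU i) (hKU hz) (hφN i hi h)
  have hsum : ∀ z ∈ K, ∑ i ∈ F, (φ i (domU z) : ℂ) • s z = s z := fun z hz => by
    rw [← Finset.sum_smul, ← Complex.ofReal_sum, hφK _ ⟨z, hz, rfl⟩, Complex.ofReal_one, one_smul]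
  refine ⟨fun z => ∑ i ∈ F, (φ i (domU z) : ℂ) • t i z, ?_, ?_, ?_⟩
  · rw [← hsum g hg]
    refine Finset.sum_congr rfl fun i hi => ?_
    by_cases h : domU g ∈ tsupport (φ i)
    · rw [htg i (hmem i hi g hg h)]
    · rw [image_eq_zero_of_notMem_tsupport h]
      simp
  · intro y hy
    have h1 := hE.approxContinuousWithinAt_sum F (K := K) (y := y)
      (s := fun i z => (φ i (domU z) : ℂ) • t i z) (r := fun i z => φ i (domU z) * δ) (by
        intro i hi
        by_cases h : domU y ∈ tsupport (φ i)
        · exact (htc i y (hmem i hi y hy h)).smul hE ((φ i).continuous.comp continuous_domU)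
            fun z => hφ0 i _
        · refine hE.approxContinuousWithinAt_of_eventually_eq_zero ?_
            fun z => mul_nonneg (hφ0 i _) hδ.le
          filter_upwards [((isClosed_tsupport (φ i)).isOpen_compl.preimage continuous_domU).mem_nhds
            h] with z hz
          rw [image_eq_zero_of_notMem_tsupport hz]
          simp)
    intro M hM
    filter_upwards [h1 M hM]
    rintro z ⟨n, hn, hn'⟩
    refine ⟨n, hn, hn'.trans ?_⟩
    rw [← Finset.sum_mul]
    exact mul_le_of_le_one_left hδ.le (hφ1 _)
  · intro y hy
    rw [← hsum y hy, ← Finset.sum_sub_distrib]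
    refine (norm_sum_le_of_le F (n := fun i => φ i (domU y) * (ε + δ)) ?_).trans ?_
    · intro i hi
      rw [← smul_sub, norm_smul, Complex.norm_real, Real.norm_of_nonneg (hφ0 i _)]
      by_cases h : domU y ∈ tsupport (φ i)
      · exact mul_le_mul_of_nonneg_left (hts i y (hmem i hi y hy h) hy) (hφ0 i _)
      · rw [image_eq_zero_of_notMem_tsupport h]
        simp
    · rw [← Finset.sum_mul, hφK _ ⟨y, hy, rfl⟩, one_mul]

/-- Refining repeatedly with errors `(1 / 2) ^ n` gives a uniformly Cauchy sequence on `K` whose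
value at `g` never changes. Fibres are complete, and the limit is continuous because the errors tend
to zero. -/
theorem exists_continuousOn_of_approx (hE : IsBanachBundle E) {U : Opens G}
    (hU : IsLocalBisection U) {K : Set G} (hK : IsCompact K) (hKU : K ⊆ U) {g : G} (hg : g ∈ K)
    {s : ∀ g, E g} (hs : ∀ y ∈ K, ApproxContinuousWithinAt s (fun _ => 1) K y) :
    ∃ s' : ∀ g, E g, s' g = s g ∧ ContinuousOn (fun z => (⟨z, s' z⟩ : Tot E)) K := by
  let P : ℕ → (∀ g, E g) → Prop := fun n t =>
    t g = s g ∧ ∀ y ∈ K, ApproxContinuousWithinAt t (fun _ => (1 / 2) ^ n) K y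
  have hstep : ∀ (n : ℕ) (t : {t // P n t}), ∃ t' : {t // P (n + 1) t},
      ∀ y ∈ K, ‖t'.1 y - t.1 y‖ ≤ 2 * (1 / 2) ^ n := by
    rintro n ⟨t, htg, ht⟩
    obtain ⟨t', h1, h2, h3⟩ :=
      hE.exists_approx_refinement hU hK hKU hg (δ := (1 / 2) ^ (n + 1)) (by positivity) ht
    refine ⟨⟨t', h1.trans htg, h2⟩, fun y hy => (h3 y hy).trans ?_⟩
    have : (0 : ℝ) < (1 / 2) ^ n := by positivity
    rw [pow_succ]
    linarith
  choose next hnext using hstep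
  let S : ∀ n, {t // P n t} := fun n =>
    Nat.rec (motive := fun n => {t // P n t}) ⟨s, rfl, by simpa using hs⟩ next n
  -- The bound `2 * (1 / 2) ^ n`, in the shape `C / 2 / 2 ^ n` with `C = 4`; the distance to the
  -- limit is then at most `4 / 2 ^ n`, whence `η / 4` below.
  have hS : ∀ n, ∀ y ∈ K, dist ((S n).1 y) ((S (n + 1)).1 y) ≤ 4 / 2 / 2 ^ n := fun n y hy => by
    rw [dist_comm, dist_eq_norm]
    refine (hnext n (S n) y hy).trans (le_of_eq ?_)
    rw [one_div, inv_pow]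
    ring
  have hlim : ∀ y, ∃ l : E y, y ∈ K → Tendsto (fun n => (S n).1 y) atTop (𝓝 l) := by
    intro y
    by_cases hy : y ∈ K
    · obtain ⟨l, hl⟩ := cauchySeq_tendsto_of_complete (cauchySeq_of_le_geometric_two (hS · y hy))
      exact ⟨l, fun _ => hl⟩
    · exact ⟨0, fun h => absurd h hy⟩
  choose s' hs' using hlim
  refine ⟨s', tendsto_nhds_unique (hs' g hg) ?_, fun y hy =>
    hE.continuousWithinAt_of_approx hy fun η hη => ?_⟩
  · simp [(S _).2.1]
  · obtain ⟨n, hn⟩ := exists_pow_lt_of_lt_one (show 0 < η / 4 by positivity)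
      (show (1 / 2 : ℝ) < 1 by norm_num)
    refine ⟨(S n).1, fun N hN => ?_, fun z hz => ?_⟩
    · filter_upwards [(S n).2.2 y hy N hN]
      rintro z ⟨m, hm, hm'⟩
      exact ⟨m, hm, hm'.trans (by linarith)⟩
    · rw [← dist_eq_norm, dist_comm]
      refine (dist_le_of_le_geometric_two_of_tendsto (hS · z hz) (hs' z hz) n).trans_lt ?_
      rw [one_div, inv_pow] at hn
      rw [div_eq_mul_inv]
      linarith

end IsBanachBundle

/-- A choice of vectors in a thin neighbourhood of `e` is continuous up to error one. It is
corrected to a continuous section on a compact neighbourhood of `g`, then multiplied by a bump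
function equal to one at `d(g)` and extended by zero. -/
theorem FellBundle.exists_mem_Cc_apply_eq (π : FellBundle E) {U : Opens G}
    (hU : IsLocalBisection U) {g : G} (hg : g ∈ U) (e : E g) : ∃ s ∈ π.Cc U, s g = e := by
  classical
  have hE := π.isBanachBundle
  have : T2Space (units G) := IsEtaleGroupoid.t2Space_units
  have : LocallyCompactSpace (units G) := IsEtaleGroupoid.locallyCompactSpace_units
  obtain ⟨W, hW, hgW, hthin⟩ := hE.exists_thin_nhds e one_pos
  have hex : ∀ z, ∃ n : E z, (z ∈ Tot.base '' W → (⟨z, n⟩ : Tot E) ∈ W) ∧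
      ∀ h : g = z, n = h ▸ e := by
    intro z
    by_cases h : g = z
    · subst h
      exact ⟨e, fun _ => hgW, fun _ => rfl⟩
    · by_cases h' : z ∈ Tot.base '' W
      · obtain ⟨q, hq, rfl⟩ := h'
        exact ⟨q.val, fun _ => hq, fun h' => absurd h' h⟩
      · exact ⟨0, fun h'' => absurd h'' h', fun h' => absurd h' h⟩
  choose t ht htg using hex
  have hO : IsOpen ((U : Set G) ∩ Tot.base '' W) := U.isOpen.inter (hE.isOpenMap_proj W hW)
  set O : Set G := (U : Set G) ∩ Tot.base '' W
  have hgO : g ∈ O := ⟨hg, _, hgW, rfl⟩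
  obtain ⟨L, hL, hgL, hLO⟩ := exists_compact_subset (isOpenMap_domU O hO) ⟨g, hgO, rfl⟩
  have hemb : IsOpenEmbedding (fun z : O => (domU z.1 : units G)) :=
    .of_continuous_injective_isOpenMap (continuous_domU.comp continuous_subtype_val)
      (fun a b h => Subtype.ext (injOn_domU hU a.2.1 b.2.1 h))
      (isOpenMap_domU.comp hO.isOpenMap_subtype_val)
  -- Since `d` embeds `O` as an open subset of `G₀` containing `L`, compactness of `L` lifts to `O`.
  have hK : IsCompact (O ∩ domU ⁻¹' L) := by
    have h1 := (hemb.isInducing.isCompact_preimage' hL (by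
      rintro _ hx
      obtain ⟨z, hz, rfl⟩ := hLO hx
      exact ⟨⟨z, hz⟩, rfl⟩)).image continuous_subtype_val
    convert h1 using 1
    ext z
    simp [and_comm]
  have hKU : O ∩ domU ⁻¹' L ⊆ U := fun z hz => hz.1.1
  obtain ⟨s, hsg, hs⟩ := hE.exists_continuousOn_of_approx hU hK hKU (g := g)
    ⟨hgO, interior_subset (s := L) hgL⟩ (s := t) fun y hy =>
      hE.approxContinuousWithinAt_of_thin hW hthin ht _ hy.1.2
  obtain ⟨φ, hφL, hφg, -⟩ := exists_tsupport_one_of_isOpen_isClosed (isOpen_interior (s := L))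
    (hL.of_isClosed_subset isClosed_closure (closure_minimal interior_subset hL.isClosed))
    (isClosed_singleton (x := domU g)) (by simpa using hgL)
  have hmem : ∀ z ∈ U, domU z ∈ L → z ∈ O := fun z hz h =>
    mem_of_domU_mem_image hU (fun _ h => h.1) hz (hLO h)
  refine ⟨fun z => if z ∈ U then (φ (domU z) : ℂ) • s z else 0, ⟨?_, _, hK, hKU, ?_⟩, ?_⟩
  · intro y hy
    refine ContinuousAt.continuousWithinAt ?_
    have hev : ∀ᶠ z in 𝓝 y, z ∈ U := U.isOpen.mem_nhds hy
    by_cases h : domU y ∈ tsupport φ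
    · have hyK : O ∩ domU ⁻¹' L ∈ 𝓝 y := inter_mem (hO.mem_nhds (hmem y hy
        (interior_subset (hφL h)))) (continuous_domU.continuousAt.preimage_mem_nhds
          (mem_interior_iff_mem_nhds.1 (hφL h)))
      have h1 := hE.tendsto_smul (((Complex.continuous_ofReal.comp φ.continuous).comp
        continuous_domU).tendsto y) (hs.continuousAt hyK)
      have h2 : (⟨y, if y ∈ U then (φ (domU y) : ℂ) • s y else 0⟩ : Tot E) =
          ⟨y, (φ (domU y) : ℂ) • s y⟩ := by rw [if_pos (show y ∈ U from hy)]
      rw [ContinuousAt, h2]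
      refine h1.congr' ?_
      filter_upwards [hev] with z hz
      simp [hz]
    · refine (hE.continuous_zero.continuousAt (x := y)).congr ?_
      filter_upwards [((isClosed_tsupport φ).isOpen_compl.preimage continuous_domU).mem_nhds h]
        with z hz
      rw [image_eq_zero_of_notMem_tsupport hz]
      simp
  · intro z hz
    have hzU : z ∈ U := by
      by_contra h
      simp [h] at hz
    have hzL : domU z ∈ L := by
      by_contra h
      have h' : domU z ∉ tsupport φ := fun h' => h (interior_subset (hφL h'))
      exact hz (by simp [image_eq_zero_of_notMem_tsupport h'])
    exact ⟨hmem z hzU hzL, hzL⟩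
  · have h1 : φ (domU g) = 1 := hφg rfl
    simp only [hg, if_true, h1, Complex.ofReal_one, one_smul]
    rw [hsg, htg g rfl]

end ExistsSection

/-! ## Spaces of compactly supported sections -/

namespace FellBundle

variable {G : Type u} [TopologicalSpace G] [TopologicalGroupoid G]
  {E : G → Type v} [∀ g, NormedAddCommGroup (E g)] [∀ g, NormedSpace ℂ (E g)]

/-- Multiplication of a section by the pullback along `d` of a function on `G₀`. -/
def scale (φ : C(units G, ℝ)) (s : ∀ g, E g) : ∀ g, E g := fun g => (φ (domU g) : ℂ) • s g

theorem norm_scale {φ : C(units G, ℝ)} (hφ : ∀ x, 0 ≤ φ x) (s : ∀ g, E g) (g : G) :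
    ‖scale φ s g‖ = φ (domU g) * ‖s g‖ := by
  rw [scale, norm_smul, Complex.norm_real, Real.norm_of_nonneg (hφ _)]

variable [∀ g, CompleteSpace (E g)] [TopologicalSpace (Tot E)] (π : FellBundle E)

/-- `C_c(U, E)` as a linear subspace of the space of all sections. -/
def CcSubmodule (U : Opens G) : Submodule ℂ (∀ g, E g) where
  carrier := π.Cc U
  zero_mem' := ⟨π.isBanachBundle.continuous_zero.continuousOn, ∅, isCompact_empty,
    Set.empty_subset _, fun _ h => absurd rfl h⟩
  add_mem' := by
    rintro s t ⟨hs, K, hK, hKU, hKs⟩ ⟨ht, L, hL, hLU, hLt⟩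
    refine ⟨fun y hy => π.isBanachBundle.tendsto_add (hs y hy) (ht y hy), K ∪ L, hK.union hL,
      Set.union_subset hKU hLU, fun g hg => ?_⟩
    by_contra h
    rw [Set.mem_union, not_or] at h
    exact hg (by simp [not_imp_comm.1 (hKs g) h.1, not_imp_comm.1 (hLt g) h.2])
  smul_mem' := by
    rintro c s ⟨hs, K, hK, hKU, hKs⟩
    exact ⟨fun y hy => π.isBanachBundle.tendsto_smul tendsto_const_nhds (hs y hy), K, hK, hKU,
      fun g hg => hKs g fun h => hg (by simp [h])⟩

variable {π} {U V : Opens G} {s t : ∀ g, E g}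

theorem mem_CcSubmodule : s ∈ π.CcSubmodule U ↔ s ∈ π.Cc U := Iff.rfl

theorem mem_of_mem_Cc (hs : s ∈ π.Cc U) {g : G} (hg : s g ≠ 0) : g ∈ U := by
  obtain ⟨-, K, -, hKU, hK⟩ := hs
  exact hKU (hK g hg)

theorem eq_zero_of_mem_Cc (hs : s ∈ π.Cc U) {g : G} (hg : g ∉ U) : s g = 0 :=
  not_imp_comm.1 (mem_of_mem_Cc hs) hg

theorem mem_sectionsC (hU : IsLocalBisection U) (hs : s ∈ π.Cc U) : s ∈ π.sectionsC :=
  Submodule.subset_span ⟨U, hU, hs⟩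

theorem scale_mem_Cc_self (hs : s ∈ π.Cc U) (φ : C(units G, ℝ)) : scale φ s ∈ π.Cc U := by
  obtain ⟨hsc, K, hK, hKU, hKs⟩ := hs
  exact ⟨fun y hy => π.isBanachBundle.tendsto_smul (((Complex.continuous_ofReal.comp
    φ.continuous).comp continuous_domU).continuousWithinAt) (hsc y hy), K, hK, hKU,
    fun z hz => hKs z fun h0 => hz (by simp [scale, h0])⟩

theorem scale_mem_Cc (hU : IsLocalBisection U) (hs : s ∈ π.Cc U) (hVU : V ≤ U)
    {φ : C(units G, ℝ)} (hφ : tsupport φ ⊆ (domU : G → units G) '' V) : scale φ s ∈ π.Cc V := by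
  obtain ⟨hsc, K, hK, hKU, hKs⟩ := scale_mem_Cc_self hs φ
  refine ⟨hsc.mono hVU, K ∩ domU ⁻¹' tsupport φ,
    hK.inter_right ((isClosed_tsupport φ).preimage continuous_domU), ?_, fun g hg => ?_⟩
  · exact fun z hz => mem_of_domU_mem_image hU hVU (hKU hz.1) (hφ hz.2)
  · refine ⟨hKs g hg, by_contra fun h => hg ?_⟩
    simp [scale, image_eq_zero_of_notMem_tsupport (show domU g ∉ tsupport φ from h)]

/-- The convolution sum has at most one nonzero term: `r(g)` determines the factor in `U` and `d(g)`
the factor in `V`. -/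
theorem conv_apply (hU : IsLocalBisection U) (hV : IsLocalBisection V) (hs : s ∈ π.Cc U)
    (ht : t ∈ π.Cc V) {g h k : G} (hh : h ∈ U) (hk : k ∈ V) (c : Comp h k g) :
    π.conv s t g = π.mul c (s h) (t k) := by
  refine finsum_eq_single _ (⟨(h, k), c⟩ : {q : G × G // Comp q.1 q.2 g}) ?_
  rintro ⟨⟨a, b⟩, hab, hg⟩ hne
  by_contra h0
  have ha : s a ≠ 0 := fun h => h0 (by change π.mul _ (s a) (t b) = 0; rw [h]; simp)
  have hb : t b ≠ 0 := fun h => h0 (by change π.mul _ (s a) (t b) = 0; rw [h]; simp)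
  refine hne ?_
  have h1 : a = h := hU.2 (mem_of_mem_Cc hs ha) hh (by
    rw [← rng_mul _ _ hab, ← rng_mul _ _ c.1]; exact congrArg rng (hg.trans c.2.symm))
  have h2 : b = k := hV.1 (mem_of_mem_Cc ht hb) hk (by
    rw [← dom_mul _ _ hab, ← dom_mul _ _ c.1]; exact congrArg dom (hg.trans c.2.symm))
  subst h1; subst h2; rfl

/-- Functions pulled back along `d` pass through the right factor because `d(h k) = d(k)`. -/
theorem conv_scale (φ : C(units G, ℝ)) (s t : ∀ g, E g) :
    π.conv s (scale φ t) = scale φ (π.conv s t) := by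
  ext g
  rw [scale, conv, conv, smul_finsum]
  refine finsum_congr fun q => ?_
  have h : domU q.1.2 = (domU g : units G) :=
    Subtype.ext ((dom_mul _ _ q.2.1).symm.trans (congrArg dom q.2.2))
  rw [scale, map_smul, h]

theorem isLocalBisection_star (hU : IsLocalBisection U) : IsLocalBisection (star U) := by
  constructor
  · intro a ha b hb hab
    rw [← TopologicalGroupoid.inv_inv a, ← TopologicalGroupoid.inv_inv b,
      hU.2 ha hb (by rw [rng_inv, rng_inv, hab])]
  · intro a ha b hb hab
    rw [← TopologicalGroupoid.inv_inv a, ← TopologicalGroupoid.inv_inv b,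
      hU.1 ha hb (by rw [dom_inv, dom_inv, hab])]

theorem star_star_opens (U : Opens G) : star (star U) = U := by
  ext g
  change TopologicalGroupoid.inv (TopologicalGroupoid.inv g) ∈ U ↔ g ∈ U
  rw [TopologicalGroupoid.inv_inv]

theorem star_le_star_opens (h : U ≤ V) : star U ≤ star V := fun _ hg => h hg

theorem sectionInv_mem_Cc (hs : s ∈ π.Cc U) : π.sectionInv s ∈ π.Cc (star U) := by
  obtain ⟨hsc, K, hK, hKU, hKs⟩ := hs
  refine ⟨?_, TopologicalGroupoid.inv '' K, hK.image TopologicalGroupoid.continuous_inv, ?_, ?_⟩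
  · refine (π.continuous_inv.comp_continuousOn (hsc.comp
      TopologicalGroupoid.continuous_inv.continuousOn fun g hg => hg)).congr fun g _ => ?_
    have hpt : ∀ (g' : G) (hg' : g' = TopologicalGroupoid.inv (TopologicalGroupoid.inv g)),
        (⟨g', π.inv hg' (s (TopologicalGroupoid.inv g))⟩ : Tot E) =
          ⟨_, π.inv rfl (s (TopologicalGroupoid.inv g))⟩ := by
      rintro _ rfl
      rfl
    exact hpt g (TopologicalGroupoid.inv_inv g).symm
  · rintro _ ⟨a, ha, rfl⟩
    change TopologicalGroupoid.inv (TopologicalGroupoid.inv a) ∈ U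
    rw [TopologicalGroupoid.inv_inv]
    exact hKU ha
  · intro g hg
    refine ⟨TopologicalGroupoid.inv g, hKs _ fun h => hg ?_, TopologicalGroupoid.inv_inv g⟩
    simp [sectionInv, h]

/-- Composition `E_g × E_h → E_k` as a continuous bilinear map. -/
noncomputable def mulCLM (π : FellBundle E) {g h k : G} (c : Comp g h k) :
    E g →L[ℂ] E h →L[ℂ] E k :=
  LinearMap.mkContinuous₂ (π.mul c) 1 fun e f => by simpa using π.norm_mul_le c e f

@[simp]
theorem mulCLM_apply {g h k : G} (c : Comp g h k) (e : E g) (f : E h) :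
    π.mulCLM c e f = π.mul c e f := rfl

variable [IsEtaleGroupoid G]

/-- Extension by zero stays continuous because the compact support is relatively closed in the
bisection `V`; this may fail for general open sets when `G` is not Hausdorff. -/
theorem Cc_mono (hV : IsLocalBisection V) (h : U ≤ V) : π.Cc U ⊆ π.Cc V := by
  rintro s ⟨hsc, K, hK, hKU, hKs⟩
  refine ⟨fun y hy => ContinuousAt.continuousWithinAt ?_, K, hK, hKU.trans h, hKs⟩
  by_cases hyK : y ∈ K
  · exact hsc.continuousAt (U.isOpen.mem_nhds (hKU hyK))
  · refine (π.isBanachBundle.continuous_zero.continuousAt (x := y)).congr ?_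
    filter_upwards [(isOpen_diff_of_isCompact hV hK (hKU.trans h)).mem_nhds ⟨hy, hyK⟩] with z hz
    rw [not_imp_comm.1 (hKs z) hz.2]

/-- Upper semicontinuity of the norm says nothing here. Instead, `π⁻¹(U)` is Hausdorff since `U` is,
so the locus where `s` agrees with the zero section is closed in `U`. -/
theorem isOpen_ne_zero (hU : IsLocalBisection U) (hs : s ∈ π.Cc U) : IsOpen {g | s g ≠ 0} := by
  have := t2Space_of_isLocalBisection hU
  have : T2Space ((Tot.base : Tot E → G) ⁻¹' U) := π.isBanachBundle.t2Space U U.isOpen this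
  have h1 : Continuous fun z : (U : Set G) =>
      (⟨⟨z, s z⟩, z.2⟩ : (Tot.base : Tot E → G) ⁻¹' U) :=
    (continuousOn_iff_continuous_domRestrict.1 hs.1).subtype_mk _
  have h2 : Continuous fun z : (U : Set G) =>
      (⟨⟨z, 0⟩, z.2⟩ : (Tot.base : Tot E → G) ⁻¹' U) :=
    (π.isBanachBundle.continuous_zero.comp continuous_subtype_val).subtype_mk _
  have h3 := U.isOpen.isOpenMap_subtype_val _ (isClosed_eq h1 h2).isOpen_compl
  convert h3 using 1
  ext g
  constructor
  · intro hg
    refine ⟨⟨g, mem_of_mem_Cc hs hg⟩, fun h => hg ?_, rfl⟩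
    simpa using h
  · rintro ⟨z, hz, rfl⟩ h
    exact hz (by simpa using h)

end FellBundle

/-! ## Closed subspaces -/

section Max

variable {A : Type w} [NonUnitalCStarAlgebra A]

theorem closedSpan_le {S : Set A} {P : ClosedSubmodule ℂ A} : closedSpan S ≤ P ↔ S ⊆ P := by
  rw [closedSpan, Submodule.closure_le, Submodule.span_le]
  rfl

theorem subset_closedSpan (S : Set A) : S ⊆ closedSpan S := closedSpan_le.1 le_rfl

theorem mul_mem_mul_closedSubmodule {V W : ClosedSubmodule ℂ A} {a b : A} (ha : a ∈ V)
    (hb : b ∈ W) : a * b ∈ V * W :=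
  subset_closedSpan _ ⟨a, ha, b, hb, rfl⟩

theorem mul_closedSubmodule_le {V W P : ClosedSubmodule ℂ A} :
    V * W ≤ P ↔ ∀ a ∈ V, ∀ b ∈ W, a * b ∈ P := by
  refine closedSpan_le.trans ⟨fun h a ha b hb => h ⟨a, ha, b, hb, rfl⟩, ?_⟩
  rintro h _ ⟨a, ha, b, hb, rfl⟩
  exact h a ha b hb

theorem mul_closedSubmodule_mono {V V' W W' : ClosedSubmodule ℂ A} (hV : V ≤ V') (hW : W ≤ W') :
    V * W ≤ V' * W' :=
  mul_closedSubmodule_le.2 fun _ ha _ hb => mul_mem_mul_closedSubmodule (hV ha) (hW hb)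

/-- Products of elements of two closed spans lie in a closed subspace as soon as the products of
generators do. -/
theorem mul_mem_of_mem_closedSpan {S T : Set A} {P : ClosedSubmodule ℂ A}
    (h : ∀ a ∈ S, ∀ b ∈ T, a * b ∈ P) {a b : A} (ha : a ∈ closedSpan S) (hb : b ∈ closedSpan T) :
    a * b ∈ P := by
  have h1 : closedSpan S ≤ P.comap ((ContinuousLinearMap.mul ℂ A).flip b) := by
    refine closedSpan_le.2 fun a ha => ?_
    have h2 : closedSpan T ≤ P.comap (ContinuousLinearMap.mul ℂ A a) :=
      closedSpan_le.2 fun b hb => h a ha b hb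
    exact h2 hb
  exact h1 ha

end Max

/-! ### Norm estimates and local approximation in the completion. -/

namespace FellBundle.CompatibleCompletion

variable {G : Type u} [TopologicalSpace G] [TopologicalGroupoid G] [IsEtaleGroupoid G]
  {E : G → Type v} [∀ g, NormedAddCommGroup (E g)] [∀ g, NormedSpace ℂ (E g)]
  [∀ g, CompleteSpace (E g)] [TopologicalSpace (Tot E)] {π : FellBundle E}
  {A : Type w} [NonUnitalCStarAlgebra A] (ι : π.CompatibleCompletion A)

theorem eval_toFun (g : G) (s : π.sectionsC) : ι.eval g (ι.toFun s) = (s : ∀ g, E g) g :=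
  LinearMap.extendOfNorm_eq ι.denseRange ⟨1, fun s => by simpa using ι.norm_apply_le s g⟩ s

theorem norm_toFun_le {U : Opens G} (hU : IsLocalBisection U) {s : π.sectionsC}
    (hs : (s : ∀ g, E g) ∈ π.Cc U) {ε : ℝ} (hε : 0 ≤ ε) (h : ∀ g, ‖(s : ∀ g, E g) g‖ ≤ ε) :
    ‖ι.toFun s‖ ≤ ε := by
  rw [ι.norm_eq U hU s hs]
  exact Real.iSup_le h hε

/-- A section in `C_c(U, E)` belongs to a closed subspace if it can be approximated locally by
elements of the subspace. -/
theorem toFun_mem_of_locally (P : ClosedSubmodule ℂ A) {U : Opens G} (hU : IsLocalBisection U)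
    {s : π.sectionsC} (hs : (s : ∀ g, E g) ∈ π.Cc U)
    (h : ∀ ε > 0, ∀ g ∈ U, ∃ N : Opens G, g ∈ N ∧ ∀ φ : C(units G, ℝ), (∀ x, 0 ≤ φ x) →
      tsupport φ ⊆ (domU : G → units G) '' N → ∃ t : π.sectionsC, (t : ∀ g, E g) ∈ π.Cc U ∧
        ι.toFun t ∈ P ∧ ∀ z, ‖scale φ s z - (t : ∀ g, E g) z‖ ≤ ε * φ (domU z)) :
    ι.toFun s ∈ P := by
  have : T2Space (units G) := IsEtaleGroupoid.t2Space_units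
  have : LocallyCompactSpace (units G) := IsEtaleGroupoid.locallyCompactSpace_units
  obtain ⟨-, K, hK, hKU, hKs⟩ := id hs
  refine P.isClosed.closure_subset (Metric.mem_closure_iff.2 fun ε hε => ?_)
  have hK' : ∀ y : K, ∃ N : Opens G, y.1 ∈ N ∧ ∀ φ : C(units G, ℝ), (∀ x, 0 ≤ φ x) →
      tsupport φ ⊆ (domU : G → units G) '' N → ∃ t : π.sectionsC, (t : ∀ g, E g) ∈ π.Cc U ∧
        ι.toFun t ∈ P ∧ ∀ z, ‖scale φ s z - (t : ∀ g, E g) z‖ ≤ ε / 2 * φ (domU z) :=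
    fun y => h _ (half_pos hε) y (hKU y.2)
  choose N hyN hN using hK'
  obtain ⟨F, φ, hφN, hφ0, hφ1, hφK⟩ := exists_partition_of_unity (hK.image continuous_domU)
    (fun y => (domU : G → units G) '' N y) (fun y => isOpenMap_domU _ (N y).isOpen) (by
      rintro _ ⟨y, hy, rfl⟩
      exact Set.mem_iUnion.2 ⟨⟨y, hy⟩, _, hyN ⟨y, hy⟩, rfl⟩)
  have hT : ∀ i, ∃ t : π.sectionsC, i ∈ F → (t : ∀ g, E g) ∈ π.Cc U ∧ ι.toFun t ∈ P ∧
      ∀ z, ‖scale (φ i) s z - (t : ∀ g, E g) z‖ ≤ ε / 2 * φ i (domU z) := by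
    intro i
    by_cases hi : i ∈ F
    · obtain ⟨t, ht⟩ := hN i (φ i) (hφ0 i) (hφN i hi)
      exact ⟨t, fun _ => ht⟩
    · exact ⟨0, fun h => absurd h hi⟩
  choose t ht using hT
  refine ⟨ι.toFun (∑ i ∈ F, t i), ?_, ?_⟩
  · rw [map_sum]
    exact sum_mem fun i hi => (ht i hi).2.1
  rw [dist_eq_norm, ← map_sub]
  -- All approximants lie in the same `C_c(U, E)`, so the C*-norm of the difference is a supremum
  -- norm and can be estimated fibre by fibre.
  have hmem : ((s - ∑ i ∈ F, t i : π.sectionsC) : ∀ g, E g) ∈ π.Cc U := by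
    rw [AddSubgroupClass.coe_sub, AddSubmonoidClass.coe_finsetSum, ← mem_CcSubmodule]
    exact sub_mem hs (sum_mem fun i hi => (ht i hi).1)
  refine (ι.norm_toFun_le hU hmem (half_pos hε).le fun z => ?_).trans_lt (half_lt_self hε)
  have hsum : (s : ∀ g, E g) z = ∑ i ∈ F, scale (φ i) s z := by
    by_cases hz : z ∈ K
    · simp only [scale]
      rw [← Finset.sum_smul, ← Complex.ofReal_sum, hφK _ ⟨z, hz, rfl⟩, Complex.ofReal_one, one_smul]
    · have h0 := not_imp_comm.1 (hKs z) hz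
      simp [scale, h0]
  rw [AddSubgroupClass.coe_sub, AddSubmonoidClass.coe_finsetSum, Pi.sub_apply, Finset.sum_apply,
    hsum, ← Finset.sum_sub_distrib]
  refine (norm_sum_le_of_le F fun i hi => (ht i hi).2.2 z).trans ?_
  rw [← Finset.mul_sum]
  exact mul_le_of_le_one_right (half_pos hε).le (hφ1 _)

end FellBundle.CompatibleCompletion

/-! ## The homomorphism `p^*` -/

namespace FellBundle.CompatibleCompletion

variable {G : Type u} [TopologicalSpace G] [TopologicalGroupoid G] [IsEtaleGroupoid G]
  {E : G → Type v} [∀ g, NormedAddCommGroup (E g)] [∀ g, NormedSpace ℂ (E g)]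
  [∀ g, CompleteSpace (E g)] [TopologicalSpace (Tot E)] {π : FellBundle E}
  {A : Type w} [NonUnitalCStarAlgebra A] (ι : π.CompatibleCompletion A)

theorem toFun_mem_restriction {U : Opens G} {s : π.sectionsC} (hs : (s : ∀ g, E g) ∈ π.Cc U) :
    ι.toFun s ∈ ι.restriction U :=
  subset_closedSpan _ ⟨s, hs, rfl⟩

theorem restriction_le {U : Opens G} {P : ClosedSubmodule ℂ A} :
    ι.restriction U ≤ P ↔ ∀ s : π.sectionsC, (s : ∀ g, E g) ∈ π.Cc U → ι.toFun s ∈ P :=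
  closedSpan_le.trans Set.image_subset_iff

theorem restriction_le_pStar {U V : Opens G} (hU : IsLocalBisection U) (h : U ≤ V) :
    ι.restriction U ≤ ι.pStar V :=
  le_iSup (fun U : {U : Opens G // IsLocalBisection U ∧ U ≤ V} => ι.restriction U) ⟨U, hU, h⟩

theorem pStar_le {V : Opens G} {P : ClosedSubmodule ℂ A} :
    ι.pStar V ≤ P ↔ ∀ U : Opens G, IsLocalBisection U → U ≤ V → ∀ s : π.sectionsC,
      (s : ∀ g, E g) ∈ π.Cc U → ι.toFun s ∈ P := by
  simp only [pStar, iSup_le_iff, restriction_le, Subtype.forall, and_imp]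

theorem pStar_mono {U V : Opens G} (h : U ≤ V) : ι.pStar U ≤ ι.pStar V :=
  ι.pStar_le.2 fun _ hW hWU _ hs =>
    ι.restriction_le_pStar hW (hWU.trans h) (ι.toFun_mem_restriction hs)

theorem pStar_eq_restriction {U : Opens G} (hU : IsLocalBisection U) :
    ι.pStar U = ι.restriction U :=
  le_antisymm
    (ι.pStar_le.2 fun _ _ hWU _ hs => ι.toFun_mem_restriction (Cc_mono hU hWU hs))
    (ι.restriction_le_pStar hU le_rfl)

/-- A partition of unity cuts a section over a bisection into pieces, each supported in a single
member of `S`; the local approximation is exact. -/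
theorem pStar_sSup (S : Set (Opens G)) : ι.pStar (sSup S) = sSup (ι.pStar '' S) := by
  refine le_antisymm (ι.pStar_le.2 fun U hU hUS s hs => ?_) (sSup_le ?_)
  · refine ι.toFun_mem_of_locally _ hU hs fun ε hε g hg => ?_
    obtain ⟨V, hV, hgV⟩ := Opens.mem_sSup.1 (hUS hg)
    refine ⟨U ⊓ V, ⟨hg, hgV⟩, fun φ hφ0 hφ => ?_⟩
    have hmem := scale_mem_Cc hU hs inf_le_left hφ
    refine ⟨⟨_, mem_sectionsC (hU.mono inf_le_left) hmem⟩, Cc_mono hU inf_le_left hmem, ?_, ?_⟩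
    · have hle : ι.pStar V ≤ sSup (ι.pStar '' S) := le_sSup (Set.mem_image_of_mem _ hV)
      exact hle (ι.restriction_le_pStar (hU.mono inf_le_left) inf_le_right
        (ι.toFun_mem_restriction hmem))
    · intro z
      simpa using mul_nonneg hε.le (hφ0 _)
  · rintro _ ⟨V, hV, rfl⟩
    exact ι.pStar_mono (le_sSup hV)

theorem pStar_star_le (V : Opens G) : ι.pStar (star V) ≤ star (ι.pStar V) := by
  refine ι.pStar_le.2 fun U hU hUV s hs => ?_
  change star (ι.toFun s) ∈ ι.pStar V
  rw [← ι.map_star]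
  refine ι.restriction_le_pStar (isLocalBisection_star hU) ?_
    (ι.toFun_mem_restriction (sectionInv_mem_Cc hs))
  rw [← star_star_opens V]
  exact star_le_star_opens hUV

theorem pStar_star (V : Opens G) : ι.pStar (star V) = star (ι.pStar V) := by
  refine le_antisymm (ι.pStar_star_le V) fun a (ha : star a ∈ ι.pStar V) => ?_
  rw [← star_star_opens V] at ha
  have h : star (star a) ∈ ι.pStar (star V) := ι.pStar_star_le _ ha
  rwa [star_star] at h

theorem restriction_mul_le {U V : Opens G} (hU : IsLocalBisection U) (hV : IsLocalBisection V) :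
    ι.restriction U * ι.restriction V ≤ ι.restriction (U * V) := by
  refine mul_closedSubmodule_le.2 fun a ha b hb => mul_mem_of_mem_closedSpan ?_ ha hb
  rintro _ ⟨s, hs, rfl⟩ _ ⟨t, ht, rfl⟩
  rw [← ι.map_mul]
  exact ι.toFun_mem_restriction (π.conv_mem_Cc hU hV hs ht)

theorem pStar_mul_le (U V : Opens G) : ι.pStar U * ι.pStar V ≤ ι.pStar (U * V) := by
  refine mul_closedSubmodule_le.2 fun a ha b hb => ?_
  have h1 : ι.pStar U ≤ (ι.pStar (U * V)).comap ((ContinuousLinearMap.mul ℂ A).flip b) := by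
    refine ι.pStar_le.2 fun U' hU' hUU' s hs => ?_
    have h2 : ι.pStar V ≤ (ι.pStar (U * V)).comap (ContinuousLinearMap.mul ℂ A (ι.toFun s)) := by
      refine ι.pStar_le.2 fun V' hV' hVV' t ht => ?_
      exact ι.restriction_le_pStar (isLocalBisection_mul hU' hV') (opens_mul_mono hUU' hVV')
        (ι.restriction_mul_le hU' hV' (mul_mem_mul_closedSubmodule (ι.toFun_mem_restriction hs)
          (ι.toFun_mem_restriction ht)))
    exact h2 hb
  exact h1 ha

/-- Elements of the span of the products `E_h E_k` extend to sections that are locally sums of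
products of sections. -/
theorem exists_section_of_mem_span {U V : Opens G} (hU : IsLocalBisection U)
    (hV : IsLocalBisection V) {g h k : G} (hh : h ∈ U) (hk : k ∈ V) (c : Comp h k g) {b : E g}
    (hb : b ∈ Submodule.span ℂ {b : E g | ∃ e f, π.mul c e f = b}) :
    ∃ t ∈ π.Cc (U * V), t g = b ∧ ∀ φ : C(units G, ℝ), ∃ t' : π.sectionsC,
      (t' : ∀ g, E g) = scale φ t ∧ ι.toFun t' ∈ ι.pStar U * ι.pStar V := by
  induction hb using Submodule.span_induction with
  | mem b hb =>
    obtain ⟨e, f, rfl⟩ := hb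
    obtain ⟨u, hu, rfl⟩ := π.exists_mem_Cc_apply_eq hU hh e
    obtain ⟨v, hv, rfl⟩ := π.exists_mem_Cc_apply_eq hV hk f
    refine ⟨π.conv u v, π.conv_mem_Cc hU hV hu hv, conv_apply hU hV hu hv hh hk c, fun φ => ?_⟩
    -- The function `φ` is absorbed into the right factor, so the scaled section is still a product.
    have hv' := scale_mem_Cc_self hv φ
    refine ⟨π.convMul ⟨u, mem_sectionsC hU hu⟩ ⟨_, mem_sectionsC hV hv'⟩, conv_scale φ u v, ?_⟩
    rw [ι.map_mul]
    exact mul_mem_mul_closedSubmodule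
      (ι.restriction_le_pStar hU le_rfl (ι.toFun_mem_restriction hu))
      (ι.restriction_le_pStar hV le_rfl (ι.toFun_mem_restriction hv'))
  | zero =>
    refine ⟨0, (π.CcSubmodule (U * V)).zero_mem, rfl, fun φ => ⟨0, ?_, ?_⟩⟩
    · ext z
      simp [scale]
    · rw [map_zero]
      exact zero_mem _
  | add b b' _ _ hb hb' =>
    obtain ⟨t, ht, rfl, h⟩ := hb
    obtain ⟨t', ht', rfl, h'⟩ := hb'
    refine ⟨t + t', (π.CcSubmodule (U * V)).add_mem ht ht', rfl, fun φ => ?_⟩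
    obtain ⟨w, hw, hwP⟩ := h φ
    obtain ⟨w', hw', hwP'⟩ := h' φ
    refine ⟨w + w', ?_, ?_⟩
    · rw [Submodule.coe_add, hw, hw']
      ext z
      simp [scale]
    · rw [map_add]
      exact add_mem hwP hwP'
  | smul r b _ hb =>
    obtain ⟨t, ht, rfl, h⟩ := hb
    refine ⟨r • t, (π.CcSubmodule (U * V)).smul_mem r ht, rfl, fun φ => ?_⟩
    obtain ⟨w, hw, hwP⟩ := h φ
    refine ⟨r • w, ?_, ?_⟩
    · rw [Submodule.coe_smul, hw]
      ext z
      simp [scale, smul_comm r]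
    · rw [map_smul]
      exact SMulMemClass.smul_mem r hwP

/-- Saturation puts `s(g)` within `ε` of a finite sum of products of vectors, hence of the value at
`g` of a section `t` built from products. By upper semicontinuity of the norm `s - t` stays below
`ε` near `g`. -/
theorem pStar_mul (hπ : π.IsSaturated) (U V : Opens G) :
    ι.pStar (U * V) = ι.pStar U * ι.pStar V := by
  refine le_antisymm (ι.pStar_le.2 fun W hW hWUV s hs => ?_) (ι.pStar_mul_le U V)
  refine ι.toFun_mem_of_locally _ hW hs fun ε hε g hg => ?_
  obtain ⟨h, hh, k, hk, c⟩ := hWUV hg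
  obtain ⟨U', hU', hhU', hUU'⟩ := exists_isLocalBisection_mem U hh
  obtain ⟨V', hV', hkV', hVV'⟩ := exists_isLocalBisection_mem V hk
  have hUV' := isLocalBisection_mul hU' hV'
  obtain ⟨b, hb, hsb⟩ : ∃ b ∈ Submodule.span ℂ {b : E g | ∃ e f, π.mul c e f = b},
      ‖(s : ∀ g, E g) g - b‖ < ε := by
    have h1 : (s : ∀ g, E g) g ∈
        (Submodule.span ℂ {b : E g | ∃ e f, π.mul c e f = b}).topologicalClosure := by
      rw [hπ h k g c]
      trivial
    obtain ⟨b, hb, h2⟩ := Metric.mem_closure_iff.1 h1 ε hε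
    exact ⟨b, hb, by rwa [← dist_eq_norm]⟩
  obtain ⟨t, ht, rfl, htφ⟩ := ι.exists_section_of_mem_span hU' hV' hhU' hkV' c hb
  have hgUV : g ∈ U' * V' := ⟨h, hhU', k, hkV', c⟩
  have hev : ∀ᶠ z in 𝓝 g, ‖(s : ∀ g, E g) z - t z‖ < ε :=
    π.isBanachBundle.eventually_norm_lt (π.isBanachBundle.tendsto_sub
      (hs.1.continuousAt (W.isOpen.mem_nhds hg))
      (ht.1.continuousAt ((U' * V' : Opens G).isOpen.mem_nhds hgUV))) hsb
  obtain ⟨N, hN, hNo, hgN⟩ := mem_nhds_iff.1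
    (inter_mem (inter_mem (W.isOpen.mem_nhds hg) ((U' * V' : Opens G).isOpen.mem_nhds hgUV)) hev)
  have hNW : (⟨N, hNo⟩ : Opens G) ≤ W := fun z hz => (hN hz).1.1
  have hNUV : (⟨N, hNo⟩ : Opens G) ≤ U' * V' := fun z hz => (hN hz).1.2
  refine ⟨⟨N, hNo⟩, hgN, fun φ hφ0 hφ => ?_⟩
  obtain ⟨t', ht', htP⟩ := htφ φ
  refine ⟨t', ?_, mul_closedSubmodule_mono (ι.pStar_mono hUU') (ι.pStar_mono hVV') htP,
    fun z => ?_⟩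
  · rw [ht']
    exact Cc_mono hW hNW (scale_mem_Cc hUV' ht hNUV hφ)
  · rw [ht']
    have h1 : scale φ (s : ∀ g, E g) z - scale φ t z = scale φ (fun z => s.1 z - t z) z := by
      simp [scale, smul_sub]
    rw [h1, norm_scale hφ0, mul_comm]
    by_cases hz : domU z ∈ tsupport φ
    · refine mul_le_mul_of_nonneg_right ?_ (hφ0 _)
      by_cases hzN : z ∈ N
      · exact (hN hzN).2.le
      -- A point outside `N` but with `d(z)` in the support of `φ` lies in neither bisection, so
      -- both sections vanish there.
      · have h2 : z ∉ W := fun h => hzN (mem_of_domU_mem_image hW hNW h (hφ hz))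
        have h3 : z ∉ U' * V' := fun h => hzN (mem_of_domU_mem_image hUV' hNUV h (hφ hz))
        simpa [eq_zero_of_mem_Cc hs h2, eq_zero_of_mem_Cc ht h3] using hε.le
    · simp [image_eq_zero_of_notMem_tsupport hz]

theorem isInvolutiveQuantaleHom_pStar (hπ : π.IsSaturated) : IsInvolutiveQuantaleHom ι.pStar :=
  ⟨ι.pStar_sSup, ι.pStar_mul hπ, ι.pStar_star⟩

/-! ## Evaluation of elements of the completion -/

theorem eq_of_mem_restriction {U : Opens G} {F : Type*} [NormedAddCommGroup F] [NormedSpace ℂ F]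
    {S T : A →L[ℂ] F}
    (h : ∀ s : π.sectionsC, (s : ∀ g, E g) ∈ π.Cc U → S (ι.toFun s) = T (ι.toFun s)) {a : A}
    (ha : a ∈ ι.restriction U) : S a = T a := by
  have h1 : ι.restriction U ≤ (⊥ : ClosedSubmodule ℂ F).comap (S - T) :=
    ι.restriction_le.2 fun s hs => by
      rw [ClosedSubmodule.mem_comap, ClosedSubmodule.mem_bot, sub_apply, h s hs, sub_self]
  exact sub_eq_zero.1 (h1 ha)

/-- Both sides are continuous and linear in each of `a` and `b`, which reduces the formula to
sections and `conv_apply`. -/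
theorem eval_mul {U V : Opens G} (hU : IsLocalBisection U) (hV : IsLocalBisection V) {a b : A}
    (ha : a ∈ ι.restriction U) (hb : b ∈ ι.restriction V) {g h k : G} (hh : h ∈ U) (hk : k ∈ V)
    (c : Comp h k g) : ι.eval g (a * b) = π.mul c (ι.eval h a) (ι.eval k b) := by
  refine ι.eq_of_mem_restriction (S := (ι.eval g).comp ((ContinuousLinearMap.mul ℂ A).flip b))
    (T := ((π.mulCLM c).flip (ι.eval k b)).comp (ι.eval h)) (fun s hs => ?_) ha
  refine ι.eq_of_mem_restriction
    (S := (ι.eval g).comp (ContinuousLinearMap.mul ℂ A (ι.toFun s)))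
    (T := (π.mulCLM c (ι.eval h (ι.toFun s))).comp (ι.eval k)) (fun t ht => ?_) hb
  simp only [ContinuousLinearMap.comp_apply, ContinuousLinearMap.mul_apply', mulCLM_apply,
    eval_toFun, ← ι.map_mul]
  exact conv_apply hU hV hs ht hh hk c

theorem eval_eq_zero_of_mem_pStar {V : Opens G} {a : A} (ha : a ∈ ι.pStar V) {g : G}
    (hg : g ∉ V) : ι.eval g a = 0 := by
  have h : ι.pStar V ≤ (⊥ : ClosedSubmodule ℂ (E g)).comap (ι.eval g) :=
    ι.pStar_le.2 fun U _ hUV s hs => by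
      rw [ClosedSubmodule.mem_comap, ClosedSubmodule.mem_bot, eval_toFun]
      exact eq_zero_of_mem_Cc hs fun h => hg (hUV h)
  exact h ha

theorem mem_sigma {V : ClosedSubmodule ℂ A} {g : G} :
    g ∈ ι.sigma V ↔ ∃ a ∈ V, g ∈ interior {g | ι.eval g a ≠ 0} := by
  change g ∈ ⋃ a ∈ V, interior {g | ι.eval g a ≠ 0} ↔ _
  simp

/-- Localizability supplies one direction, as `γ(U)` contains every element with `σ` inside `U`; the
other holds because elements of `p^*(U)` evaluate to zero off `U`. -/
theorem galoisConnection_sigma (hA : ι.IsLocalizable) : GaloisConnection ι.sigma ι.pStar := by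
  intro P U
  constructor
  · intro h a ha
    rw [hA]
    refine subset_closedSpan _ (le_trans (fun g hg => ?_) h : ι.sigma (closedSpan {a}) ≤ U)
    obtain ⟨b, hb, hgb⟩ := ι.mem_sigma.1 hg
    exact ι.mem_sigma.2 ⟨b, closedSpan_le.2 (Set.singleton_subset_iff.2 ha) hb, hgb⟩
  · intro h g hg
    obtain ⟨a, ha, hga⟩ := ι.mem_sigma.1 hg
    by_contra hgU
    exact interior_subset hga (ι.eval_eq_zero_of_mem_pStar (h ha) hgU)

end FellBundle.CompatibleCompletion

/-! ## The fibres of a Fell bundle -/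

section Fibres

variable {G : Type u} [TopologicalSpace G] [TopologicalGroupoid G]

theorem comp_inv_self (g : G) : Comp (TopologicalGroupoid.inv g) g (dom g) :=
  ⟨dom_inv g, TopologicalGroupoid.inv_mul g⟩

theorem comp_self_inv (g : G) : Comp g (TopologicalGroupoid.inv g) (rng g) :=
  ⟨(rng_inv g).symm, TopologicalGroupoid.mul_inv g⟩

theorem comp_rng_self (g : G) : Comp (rng g) g g := ⟨dom_rng g, rng_mul_self g⟩

theorem comp_self_dom (g : G) : Comp g (dom g) g :=
  ⟨(rng_dom g).symm, TopologicalGroupoid.mul_dom g⟩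

theorem comp_dom_dom (g : G) : Comp (dom g) (dom g) (dom g) := by
  simpa only [dom_dom] using comp_self_dom (dom g)

theorem comp_rng_rng (g : G) : Comp (rng g) (rng g) (rng g) := by
  simpa only [rng_rng] using comp_rng_self (rng g)

/-- The hypothesis `Comp x x x` expresses that `x` is a unit: in a groupoid the idempotents are the
units. -/
theorem inv_of_comp_self {x : G} (c : Comp x x x) : TopologicalGroupoid.inv x = x := by
  have hx : dom x = x := by
    have h := TopologicalGroupoid.mul_inv_cancel_right' c.1
    rw [c.2, TopologicalGroupoid.mul_inv, ← c.1] at h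
    exact h
  have h1 := TopologicalGroupoid.mul_dom (TopologicalGroupoid.inv x)
  rw [dom_inv, ← c.1, hx, TopologicalGroupoid.inv_mul, hx] at h1
  exact h1.symm

namespace FellBundle

variable {E : G → Type v} [∀ g, NormedAddCommGroup (E g)] [∀ g, NormedSpace ℂ (E g)]
  [∀ g, CompleteSpace (E g)] [TopologicalSpace (Tot E)] {π : FellBundle E}

theorem norm_inv_mul_self {g y x : G} (hy : y = TopologicalGroupoid.inv g) (c : Comp y g x)
    (e : E g) : ‖π.mul c (π.inv hy e) e‖ = ‖e‖ ^ 2 := by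
  subst hy
  exact π.norm_inv_mul c e

theorem norm_mul_inv_self {g y x : G} (hy : y = TopologicalGroupoid.inv g) (c : Comp g y x)
    (e : E g) : ‖π.mul c e (π.inv hy e)‖ = ‖e‖ ^ 2 := by
  have hg : g = TopologicalGroupoid.inv y := by rw [hy, TopologicalGroupoid.inv_inv]
  have h := norm_inv_mul_self (π := π) hg c (π.inv hy e)
  rwa [π.inv_inv hy hg, π.norm_inv] at h

/-- The C*-identity for the self-adjoint element `e e^*`; it shows that this element does not square
to zero unless it is zero. -/
theorem norm_sq_mul_inv {g y x : G} (hy : y = TopologicalGroupoid.inv g) (c : Comp g y x)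
    (cx : Comp x x x) (e : E g) :
    ‖π.mul cx (π.mul c e (π.inv hy e)) (π.mul c e (π.inv hy e))‖ =
      ‖π.mul c e (π.inv hy e)‖ ^ 2 := by
  have hx : x = TopologicalGroupoid.inv x := (inv_of_comp_self cx).symm
  have hg : g = TopologicalGroupoid.inv y := by rw [hy, TopologicalGroupoid.inv_inv]
  have h := norm_inv_mul_self (π := π) hx cx (π.mul c e (π.inv hy e))
  rwa [π.inv_mul c c hy hg hx, π.inv_inv hy hg] at h

theorem exists_smul_eq_of_finrank_eq_one {F : Type*} [AddCommGroup F] [Module ℂ F]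
    (h : Module.finrank ℂ F = 1) {v : F} (hv : v ≠ 0) (w : F) : ∃ c : ℂ, c • v = w :=
  (finrank_eq_one_iff_of_nonzero' v hv).1 h w

/-- If `e f = 0` then `p = e^* e` and `q = f f^*` satisfy `p q = 0` in one fibre over a unit. That
fibre is a line, so `p` is a nonzero multiple of `q` and `q² = 0`, against the C*-identity. -/
theorem IsLineBundle.mul_ne_zero (hL : π.IsLineBundle) {g h k : G} (c : Comp g h k) {e : E g}
    {f : E h} (he : e ≠ 0) (hf : f ≠ 0) : π.mul c e f ≠ 0 := by
  intro h0
  have hx : dom g = rng h := c.1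
  have c₁ : Comp (TopologicalGroupoid.inv g) g (rng h) := hx ▸ comp_inv_self g
  have c₂ : Comp (TopologicalGroupoid.inv g) k h := by
    refine ⟨by rw [dom_inv, ← c.2, rng_mul _ _ c.1], ?_⟩
    rw [← c.2, ← TopologicalGroupoid.mul_assoc _ _ _ (dom_inv g) c.1,
      TopologicalGroupoid.inv_mul, hx, rng_mul_self]
  set p := π.mul c₁ (π.inv rfl e) e with hp
  set q := π.mul (comp_self_inv h) f (π.inv rfl f) with hq
  have hp0 : p ≠ 0 := by
    rw [← norm_ne_zero_iff, hp, norm_inv_mul_self]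
    simpa using he
  have hq0 : q ≠ 0 := by
    rw [← norm_ne_zero_iff, hq, norm_mul_inv_self]
    simpa using hf
  have hpf : π.mul (comp_rng_self h) p f = 0 := by
    rw [hp, π.mul_assoc c₁ (comp_rng_self h) c c₂, h0, map_zero]
  have hpq : π.mul (comp_rng_rng h) p q = 0 := by
    rw [hq, ← π.mul_assoc (comp_rng_self h) (comp_self_inv h), hpf, map_zero, LinearMap.zero_apply]
  obtain ⟨r, hr⟩ := exists_smul_eq_of_finrank_eq_one (hL _) hq0 p
  have hr0 : r ≠ 0 := by
    rintro rfl
    exact hp0 (by rw [← hr, zero_smul])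
  rw [← hr, map_smul, LinearMap.smul_apply, smul_eq_zero, or_iff_right hr0] at hpq
  have h1 := norm_sq_mul_inv (π := π) rfl (comp_self_inv h) (comp_rng_rng h) f
  rw [← hq, hpq, norm_zero] at h1
  exact hq0 (by simpa using h1.symm)

theorem IsLineBundle.isAbelian (hL : π.IsLineBundle) : π.IsAbelian := by
  intro x c e f
  by_cases he : e = 0
  · simp [he]
  obtain ⟨r, rfl⟩ := exists_smul_eq_of_finrank_eq_one (hL x) he f
  simp

/-- If the fibres over the units are one-dimensional, then so is every nonzero fibre of a saturated
Fell bundle. -/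
theorem finrank_eq_one_of_units (hπ : π.IsSaturated)
    (hunits : ∀ x : G, Comp x x x → Module.finrank ℂ (E x) = 1) {g : G} {e : E g} (he : e ≠ 0) :
    Module.finrank ℂ (E g) = 1 := by
  set p := π.mul (comp_self_inv g) e (π.inv rfl e) with hp
  have hp0 : p ≠ 0 := by
    rw [← norm_ne_zero_iff, hp, norm_mul_inv_self]
    simpa using he
  have hq0 : π.mul (comp_inv_self g) (π.inv rfl e) e ≠ 0 := by
    rw [← norm_ne_zero_iff, norm_inv_mul_self]
    simpa using he
  have hone := fun q => exists_smul_eq_of_finrank_eq_one (hunits _ (comp_rng_rng g)) hp0 q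
  obtain ⟨r, hr⟩ := hone (π.mul (comp_rng_rng g) p p)
  have hr0 : r ≠ 0 := by
    rintro rfl
    have h1 := norm_sq_mul_inv (π := π) rfl (comp_self_inv g) (comp_rng_rng g) e
    rw [← hp, ← hr, zero_smul, norm_zero] at h1
    exact hp0 (by simpa using h1.symm)
  -- Since `p² = r p` and `p` spans its fibre, `p` acts as `r` on every product `q f`; saturation
  -- and continuity extend this to all of `E_g`.
  have hpf : ∀ f : E g, π.mul (comp_rng_self g) p f = r • f := by
    intro f
    have hle : (Submodule.span ℂ {b : E g | ∃ q f, π.mul (comp_rng_self g) q f = b}) ≤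
        LinearMap.ker (π.mulCLM (comp_rng_self g) p -
          r • ContinuousLinearMap.id ℂ (E g)).toLinearMap := by
      refine Submodule.span_le.2 ?_
      rintro _ ⟨q, f, rfl⟩
      obtain ⟨z, rfl⟩ := hone q
      change π.mul (comp_rng_self g) p (π.mul (comp_rng_self g) (z • p) f) -
        r • π.mul (comp_rng_self g) (z • p) f = 0
      rw [← π.mul_assoc (comp_rng_rng g) (comp_rng_self g), map_smul, ← hr]
      simp only [map_smul, LinearMap.smul_apply]
      rw [smul_comm, sub_self]
    have hcl := Submodule.topologicalClosure_minimal _ hle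
      (ContinuousLinearMap.isClosed_ker
        (π.mulCLM (comp_rng_self g) p - r • ContinuousLinearMap.id ℂ (E g)))
    rw [hπ] at hcl
    exact sub_eq_zero.1 (hcl (Submodule.mem_top (x := f)))
  refine (finrank_eq_one_iff_of_nonzero' e he).2 fun f => ?_
  -- Writing `e^* f = z e^* e` gives `r f = e e^* f = z e e^* e = r z e`, so `f = z e`.
  obtain ⟨z, hz⟩ := exists_smul_eq_of_finrank_eq_one (hunits _ (comp_dom_dom g)) hq0
    (π.mul (comp_inv_self g) (π.inv rfl e) f)
  refine ⟨z, smul_right_injective _ hr0 ?_⟩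
  change r • z • e = r • f
  rw [← hpf f, hp, π.mul_assoc (comp_self_inv g) (comp_rng_self g) (comp_inv_self g)
    (comp_self_dom g), ← hz, map_smul, ← π.mul_assoc (comp_self_inv g) (comp_rng_self g), ← hp, hpf,
    smul_comm]

/-! ### The C*-algebra of a unit -/

/-- The fibre over a unit `x`, as a C*-algebra. -/
def UnitFibre (_π : FellBundle E) {x : G} (_c : Comp x x x) : Type v := E x

namespace UnitFibre

variable {x : G} {c : Comp x x x}

noncomputable instance : NormedAddCommGroup (π.UnitFibre c) :=
  inferInstanceAs (NormedAddCommGroup (E x))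

noncomputable instance : NormedSpace ℂ (π.UnitFibre c) := inferInstanceAs (NormedSpace ℂ (E x))

instance : CompleteSpace (π.UnitFibre c) := inferInstanceAs (CompleteSpace (E x))

noncomputable instance : NonUnitalNormedRing (π.UnitFibre c) where
  mul a b := π.mul c a b
  left_distrib a b b' := map_add (π.mul c a) b b'
  right_distrib a a' b := LinearMap.congr_fun (map_add (π.mul c) a a') b
  zero_mul b := LinearMap.congr_fun (map_zero (π.mul c)) b
  mul_zero a := map_zero (π.mul c a)
  mul_assoc a b b' := π.mul_assoc c c c c a b b'
  norm_mul_le a b := π.norm_mul_le c a b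
  dist_eq := NormedAddGroup.dist_eq

noncomputable instance : StarRing (π.UnitFibre c) where
  star a := π.inv (inv_of_comp_self c).symm a
  star_involutive a := π.inv_inv _ _ a
  star_mul a b := π.inv_mul c c _ _ _ a b
  star_add a b := map_add (π.inv (inv_of_comp_self c).symm) a b

instance : CStarRing (π.UnitFibre c) where
  norm_mul_self_le a :=
    ((norm_inv_mul_self (π := π) (inv_of_comp_self c).symm c a).trans (sq _)).ge

noncomputable instance : NonUnitalCStarAlgebra (π.UnitFibre c) where
  smul_assoc r a b := LinearMap.congr_fun (map_smul (π.mul c) r a) b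
  smul_comm r a b := (map_smul (π.mul c a) r b).symm
  star_smul r a := map_smulₛₗ (π.inv (inv_of_comp_self c).symm) r a

end UnitFibre

end FellBundle

end Fibres

/-! ## C*-algebras without zero divisors -/

section CStar

variable {B : Type*} [NonUnitalCStarAlgebra B]

/-- Two distinct nonzero spectral values would carry bump functions with product zero, giving zero
divisors by functional calculus. So the quasispectrum lies in `{0, r}`, where `x² = r x`. -/
theorem IsSelfAdjoint.exists_mul_self_eq_smul [NoZeroDivisors B] {a : B} (ha : IsSelfAdjoint a)
    (ha0 : a ≠ 0) : ∃ r : ℝ, r ≠ 0 ∧ a * a = r • a := by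
  obtain ⟨r, hr, hr0⟩ : ∃ r ∈ quasispectrum ℝ a, r ≠ 0 := by
    by_contra! h
    exact ha0 (CFC.eq_zero_of_quasispectrum_eq_zero (R := ℝ) (h_spec := fun r hr => h r hr)
      (ha := ha))
  have hspec : ∀ t ∈ quasispectrum ℝ a, t = 0 ∨ t = r := by
    intro t ht
    by_contra! h
    obtain ⟨ht0, htr⟩ := h
    -- The first two bounds make the bumps vanish at `0`, as the non-unital calculus requires; the
    -- third makes them disjoint.
    set δ := min (min |r| |t|) (|r - t| / 2) with hδ
    have hδ0 : 0 < δ := by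
      simp only [hδ, lt_min_iff, abs_pos]
      exact ⟨⟨hr0, ht0⟩, half_pos (abs_pos.2 (sub_ne_zero.2 htr.symm))⟩
    have hδr : δ ≤ |r| := (min_le_left _ _).trans (min_le_left _ _)
    have hδt : δ ≤ |t| := (min_le_left _ _).trans (min_le_right _ _)
    have hδrt : δ ≤ |r - t| / 2 := min_le_right _ _
    let f : ℝ → ℝ → ℝ := fun c x => max 0 (δ - |x - c|)
    have hfc : ∀ c, Continuous (f c) := fun c => by fun_prop
    have hf0 : ∀ c, δ ≤ |c| → f c 0 = 0 := fun c hc => by simp [f, hc]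
    have hfne : ∀ c ∈ quasispectrum ℝ a, δ ≤ |c| → cfcₙ (f c) a ≠ 0 := by
      intro c hc hδc h
      rw [← cfcₙ_const_zero ℝ a] at h
      have h1 := eqOn_of_cfcₙ_eq_cfcₙ h ha (hfc c).continuousOn (hf0 c hδc)
        continuousOn_const rfl hc
      simp [f] at h1
      linarith
    have hmul : cfcₙ (f r) a * cfcₙ (f t) a = 0 := by
      rw [← cfcₙ_mul (f r) (f t) a (hfc r).continuousOn (hf0 r hδr) (hfc t).continuousOn
        (hf0 t hδt), ← cfcₙ_const_zero ℝ a]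
      refine cfcₙ_congr fun x _ => ?_
      by_contra h
      obtain ⟨h1, h2⟩ := mul_ne_zero_iff.1 h
      have h3 : |x - r| < δ := by
        by_contra h3
        exact h1 (max_eq_left (by linarith))
      have h4 : |x - t| < δ := by
        by_contra h4
        exact h2 (max_eq_left (by linarith))
      have h5 : |r - t| ≤ |x - r| + |x - t| := by
        rw [abs_sub_comm x r]
        exact abs_sub_le r x t
      linarith
    rcases mul_eq_zero.1 hmul with h | h
    · exact hfne r hr hδr h
    · exact hfne t ht hδt h
  refine ⟨r, hr0, ?_⟩
  calc a * a = cfcₙ (fun x : ℝ => x * x) a := by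
        rw [cfcₙ_mul (fun x : ℝ => x) (fun x : ℝ => x) a, cfcₙ_id' ℝ a]
    _ = cfcₙ (fun x : ℝ => r * x) a := cfcₙ_congr fun x hx => by
        rcases hspec x hx with rfl | rfl <;> simp
    _ = r • a := cfcₙ_const_mul_id r a

/-- Cancellation in `a² = r a` gives `a y = r y`, and in `y² = t y` gives `a y = t a`. Hence every
self-adjoint `y` is a multiple of `a`, and real and imaginary parts do the rest. -/
theorem finrank_eq_one_of_noZeroDivisors [NoZeroDivisors B] [Nontrivial B] :
    Module.finrank ℂ B = 1 := by
  obtain ⟨b, hb⟩ := exists_ne (0 : B)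
  have hs : IsSelfAdjoint (star b * b) := IsSelfAdjoint.star_mul_self b
  have hs0 : star b * b ≠ 0 := mul_ne_zero (star_ne_zero.2 hb) hb
  set a := star b * b
  obtain ⟨r, hr, har⟩ := hs.exists_mul_self_eq_smul hs0
  have hsa : ∀ y : B, IsSelfAdjoint y → ∃ z : ℂ, z • a = y := by
    intro y hy
    by_cases hy0 : y = 0
    · exact ⟨0, by simp [hy0]⟩
    obtain ⟨t, -, hyt⟩ := hy.exists_mul_self_eq_smul hy0
    have h1 : a * y = r • y := by
      refine mul_left_cancel₀ hs0 ?_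
      rw [← mul_assoc, har, smul_mul_assoc, mul_smul_comm]
    have h2 : a * y = t • a := by
      refine mul_right_cancel₀ hy0 ?_
      rw [mul_assoc, hyt, smul_mul_assoc, mul_smul_comm]
    refine ⟨((r⁻¹ * t : ℝ) : ℂ), ?_⟩
    rw [Complex.coe_smul, mul_smul, ← h2, h1, inv_smul_smul₀ hr]
  refine (finrank_eq_one_iff_of_nonzero' a hs0).2 fun y => ?_
  obtain ⟨z₁, h₁⟩ := hsa _ (realPart y).2
  obtain ⟨z₂, h₂⟩ := hsa _ (imaginaryPart y).2
  refine ⟨z₁ + Complex.I * z₂, ?_⟩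
  rw [add_smul, mul_smul, h₁, h₂]
  exact realPart_add_I_smul_imaginaryPart y

end CStar

/-! ## Line bundles and quantic bundles -/

namespace FellBundle.CompatibleCompletion

variable {G : Type u} [TopologicalSpace G] [TopologicalGroupoid G] [IsEtaleGroupoid G]
  {E : G → Type v} [∀ g, NormedAddCommGroup (E g)] [∀ g, NormedSpace ℂ (E g)]
  [∀ g, CompleteSpace (E g)] [TopologicalSpace (Tot E)] {π : FellBundle E}
  {A : Type w} [NonUnitalCStarAlgebra A] (ι : π.CompatibleCompletion A)

theorem le_of_pStar_le (hne : ∀ g, ∃ e : E g, e ≠ 0) {U V : Opens G}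
    (h : ι.pStar U ≤ ι.pStar V) : U ≤ V := by
  intro g hg
  by_contra hgV
  obtain ⟨W, hW, hgW, hWU⟩ := exists_isLocalBisection_mem U hg
  obtain ⟨e, he⟩ := hne g
  obtain ⟨s, hs, rfl⟩ := π.exists_mem_Cc_apply_eq hW hgW e
  have h1 := ι.eval_eq_zero_of_mem_pStar (h (ι.restriction_le_pStar hW hWU
    (ι.toFun_mem_restriction (s := ⟨s, mem_sectionsC hW hs⟩) hs))) hgV
  rw [eval_toFun] at h1
  exact he h1

theorem isQuanticBundle_of_isLineBundle (hπ : π.IsSaturated) (hA : ι.IsLocalizable)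
    (hL : π.IsLineBundle) : IsQuanticBundle ι.pStar := by
  have hne : ∀ g, ∃ e : E g, e ≠ 0 := fun g => by
    have := Module.nontrivial_of_finrank_eq_succ (hL g)
    exact exists_ne 0
  have gc := ι.galoisConnection_sigma hA
  refine ⟨ι.isInvolutiveQuantaleHom_pStar hπ, fun U V h => le_antisymm
    (ι.le_of_pStar_le hne h.le) (ι.le_of_pStar_le hne h.ge), ι.sigma, gc, fun U a b ha hb => ?_⟩
  refine le_antisymm (gc.l_le ?_) ?_
  -- This inclusion is formal: the unit of the adjunction and multiplicativity of `p^*`.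
  · rw [ι.pStar_mul hπ, ι.pStar_mul hπ]
    exact mul_closedSubmodule_mono (mul_closedSubmodule_mono (gc.le_u_l a) le_rfl) (gc.le_u_l b)
  rintro g ⟨m, ⟨h, hh, k, hk, c₁⟩, l, hl, c₂⟩
  obtain ⟨α, hα, hhα⟩ := ι.mem_sigma.1 hh
  obtain ⟨β, hβ, hlβ⟩ := ι.mem_sigma.1 hl
  obtain ⟨W, hW, hkW, hWU⟩ := exists_isLocalBisection_mem U hk
  obtain ⟨e, he⟩ := hne k
  obtain ⟨s, hs, rfl⟩ := π.exists_mem_Cc_apply_eq hW hkW e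
  set w := ι.toFun ⟨s, mem_sectionsC hW hs⟩ with hw
  have hwW : w ∈ ι.restriction W := ι.toFun_mem_restriction hs
  have hαa : α ∈ ι.restriction (ι.sigma a) := by
    rw [← ι.pStar_eq_restriction ha]
    exact gc.le_u_l a hα
  have hβb : β ∈ ι.restriction (ι.sigma b) := by
    rw [← ι.pStar_eq_restriction hb]
    exact gc.le_u_l b hβ
  have haW := isLocalBisection_mul ha hW
  -- On the open set `O₁ * O₂ * O₃` the element `α * w * β` evaluates to a product of three nonzero
  -- vectors; the bisection hypotheses are what make evaluation multiplicative.
  let O₁ : Opens G := ⟨interior {g | ι.eval g α ≠ 0}, isOpen_interior⟩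
  let O₂ : Opens G := ⟨{g | s g ≠ 0}, isOpen_ne_zero hW hs⟩
  let O₃ : Opens G := ⟨interior {g | ι.eval g β ≠ 0}, isOpen_interior⟩
  refine ι.mem_sigma.2 ⟨α * w * β, mul_mem_mul_closedSubmodule (mul_mem_mul_closedSubmodule hα
    (ι.restriction_le_pStar hW hWU hwW)) hβ, mem_interior.2 ⟨(O₁ * O₂ * O₃ : Opens G), ?_,
    Opens.isOpen _, ⟨m, ⟨h, hhα, k, he, c₁⟩, l, hlβ, c₂⟩⟩⟩
  rintro g' ⟨m', ⟨h', hh', k', hk', c₁'⟩, l', hl', c₂'⟩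
  have hh'a : h' ∈ ι.sigma a := ι.mem_sigma.2 ⟨α, hα, hh'⟩
  have hl'b : l' ∈ ι.sigma b := ι.mem_sigma.2 ⟨β, hβ, hl'⟩
  have hk'W : k' ∈ W := mem_of_mem_Cc hs hk'
  change ι.eval g' (α * w * β) ≠ 0
  rw [ι.eval_mul haW hb (ι.restriction_mul_le ha hW (mul_mem_mul_closedSubmodule hαa hwW)) hβb
    ⟨h', hh'a, k', hk'W, c₁'⟩ hl'b c₂', ι.eval_mul ha hW hαa hwW hh'a hk'W c₁', hw, eval_toFun]
  exact hL.mul_ne_zero _ (hL.mul_ne_zero _ (interior_subset hh') hk') (interior_subset hl')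

/-- If `E_g = 0`, sections are small near `g` by upper semicontinuity, so they are approximated by
zero there; deleting `g` from a bisection `V` then does not change `A|_V`. -/
theorem exists_ne_zero_of_injective (hinj : Function.Injective ι.pStar) (g : G) :
    ∃ e : E g, e ≠ 0 := by
  by_contra! hzero
  obtain ⟨V, hV, hgV, -⟩ := exists_isLocalBisection_mem (⊤ : Opens G) (Opens.mem_top g)
  let V' : Opens G := ⟨(V : Set G) \ {g},
    isOpen_diff_of_isCompact hV isCompact_singleton (Set.singleton_subset_iff.2 hgV)⟩
  have hV'V : V' ≤ V := fun _ hz => hz.1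
  have hV' : IsLocalBisection V' := hV.mono hV'V
  have hle : ι.pStar V ≤ ι.pStar V' := by
    rw [ι.pStar_eq_restriction hV, ι.pStar_eq_restriction hV', restriction_le]
    intro s hs
    refine ι.toFun_mem_of_locally _ hV hs fun ε hε y hy => ?_
    by_cases hyg : y = g
    · subst hyg
      have hev : ∀ᶠ z in 𝓝 y, ‖(s : ∀ g, E g) z‖ < ε :=
        π.isBanachBundle.eventually_norm_lt (hs.1.continuousAt (V.isOpen.mem_nhds hy))
          (by simpa [hzero] using hε)
      obtain ⟨N, hN, hNo, hyN⟩ := mem_nhds_iff.1 (inter_mem (V.isOpen.mem_nhds hy) hev)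
      refine ⟨⟨N, hNo⟩, hyN, fun φ hφ0 hφ => ⟨0, (π.CcSubmodule V).zero_mem, ?_, fun z => ?_⟩⟩
      · rw [map_zero]
        exact zero_mem _
      · rw [Submodule.coe_zero, Pi.zero_apply, sub_zero, norm_scale hφ0, mul_comm]
        by_cases hz : domU z ∈ tsupport φ
        · refine mul_le_mul_of_nonneg_right ?_ (hφ0 _)
          by_cases hzV : z ∈ V
          · exact (hN (mem_of_domU_mem_image hV (fun _ h => (hN h).1) hzV (hφ hz))).2.le
          · simpa [eq_zero_of_mem_Cc hs hzV] using hε.le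
        · simp [image_eq_zero_of_notMem_tsupport hz]
    · refine ⟨V', ⟨hy, hyg⟩, fun φ hφ0 hφ => ?_⟩
      have hmem := scale_mem_Cc hV hs hV'V hφ
      refine ⟨⟨_, mem_sectionsC hV' hmem⟩, Cc_mono hV hV'V hmem, ι.toFun_mem_restriction hmem,
        fun z => ?_⟩
      simpa using mul_nonneg hε.le (hφ0 _)
  have heq : V = V' := hinj (le_antisymm hle (ι.pStar_mono hV'V))
  rw [heq] at hgV
  exact hgV.2 rfl

theorem eq_zero_or_eq_zero_of_mul_eq_zero (hA : ι.IsLocalizable) (hab : π.IsAbelian)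
    (hq : IsQuanticBundle ι.pStar) {x : G} (c : Comp x x x) {e f : E x} (hef : π.mul c e f = 0) :
    e = 0 ∨ f = 0 := by
  by_contra! hne
  obtain ⟨he, hf⟩ := hne
  obtain ⟨-, -, pLower, gc, hmul⟩ := hq
  have gc' := ι.galoisConnection_sigma hA
  -- Left adjoints are unique, so the given one can be computed by evaluations.
  obtain rfl : pLower = ι.sigma := funext fun P => gc.l_unique gc' fun _ => rfl
  obtain ⟨V, hV, hxV, -⟩ := exists_isLocalBisection_mem (⊤ : Opens G) (Opens.mem_top x)
  obtain ⟨s, hs, rfl⟩ := π.exists_mem_Cc_apply_eq hV hxV e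
  obtain ⟨t, ht, rfl⟩ := π.exists_mem_Cc_apply_eq hV hxV f
  have hspan : ∀ u : π.sectionsC, (u : ∀ g, E g) ∈ π.Cc V →
      closedSpan {ι.toFun u} ≤ ι.restriction V := fun u hu =>
    closedSpan_le.2 (Set.singleton_subset_iff.2 (ι.toFun_mem_restriction hu))
  have hbis : ∀ u : π.sectionsC, (u : ∀ g, E g) ∈ π.Cc V →
      IsLocalBisection (ι.sigma (closedSpan {ι.toFun u})) := fun u hu =>
    hV.mono (gc'.l_le ((hspan u hu).trans (ι.restriction_le_pStar hV le_rfl)))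
  have hmem : ∀ u : π.sectionsC, (u : ∀ g, E g) ∈ π.Cc V → (u : ∀ g, E g) x ≠ 0 →
      x ∈ ι.sigma (closedSpan {ι.toFun u}) := fun u hu hux => by
    refine ι.mem_sigma.2 ⟨ι.toFun u, subset_closedSpan _ rfl, ?_⟩
    simp only [eval_toFun]
    rwa [(isOpen_ne_zero hV hu).interior_eq]
  set s' : π.sectionsC := ⟨s, mem_sectionsC hV hs⟩
  set t' : π.sectionsC := ⟨t, mem_sectionsC hV ht⟩
  have hx : x ∈ ι.sigma (closedSpan {ι.toFun s'} * ι.pStar V * closedSpan {ι.toFun t'}) := by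
    rw [hmul V _ _ (hbis s' hs) (hbis t' ht)]
    exact ⟨x, ⟨x, hmem s' hs he, x, hxV, c⟩, x, hmem t' ht hf, c⟩
  obtain ⟨y, hy, hxy⟩ := ι.mem_sigma.1 hx
  have hVp := ι.pStar_eq_restriction hV
  -- The use of commutativity: `e w f = w e f = 0` for every value `w` at `x` of an element of
  -- `p^*(V)`.
  have h1 : ∀ y ∈ closedSpan {ι.toFun s'} * ι.pStar V, π.mul c (ι.eval x y) (t x) = 0 := by
    have h2 : closedSpan {ι.toFun s'} * ι.pStar V ≤ (⊥ : ClosedSubmodule ℂ (E x)).comap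
        (((π.mulCLM c).flip (t x)).comp (ι.eval x)) := by
      refine mul_closedSubmodule_le.2 fun α hα w hw => ?_
      have h3 : closedSpan {ι.toFun s'} ≤ (⊥ : ClosedSubmodule ℂ (E x)).comap
          (((π.mulCLM c).flip (t x)).comp (((π.mulCLM c).flip (ι.eval x w)).comp (ι.eval x))) := by
        refine closedSpan_le.2 (Set.singleton_subset_iff.2 ?_)
        change π.mul c (π.mul c (ι.eval x (ι.toFun s')) (ι.eval x w)) (t x) = 0
        rw [eval_toFun, hab x c _ (ι.eval x w), π.mul_assoc c c c c]
        exact (congrArg _ hef).trans (map_zero _)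
      change π.mul c (ι.eval x (α * w)) (t x) = 0
      rw [hVp] at hw
      rw [ι.eval_mul hV hV (hspan s' hs hα) hw hxV hxV c]
      exact h3 hα
    exact fun y hy => h2 hy
  have h4 : closedSpan {ι.toFun s'} * ι.pStar V * closedSpan {ι.toFun t'} ≤
      (⊥ : ClosedSubmodule ℂ (E x)).comap (ι.eval x) := by
    refine mul_closedSubmodule_le.2 fun y hy β hβ => ?_
    have h5 : closedSpan {ι.toFun t'} ≤ (⊥ : ClosedSubmodule ℂ (E x)).comap
        ((π.mulCLM c (ι.eval x y)).comp (ι.eval x)) := by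
      refine closedSpan_le.2 (Set.singleton_subset_iff.2 ?_)
      change π.mul c (ι.eval x y) (ι.eval x (ι.toFun t')) = 0
      rw [eval_toFun]
      exact h1 y hy
    have hyV : y ∈ ι.restriction (V * V) :=
      ι.restriction_mul_le hV hV (mul_closedSubmodule_mono (hspan s' hs) hVp.le hy)
    change ι.eval x (y * β) = 0
    rw [ι.eval_mul (isLocalBisection_mul hV hV) hV hyV (hspan t' ht hβ) ⟨x, hxV, x, hxV, c⟩ hxV c]
    exact h5 hβ
  exact interior_subset hxy (h4 hy)

theorem isLineBundle_of_isQuanticBundle (hπ : π.IsSaturated) (hA : ι.IsLocalizable)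
    (hab : π.IsAbelian) (hq : IsQuanticBundle ι.pStar) : π.IsLineBundle := by
  have hne := ι.exists_ne_zero_of_injective hq.2.1
  intro g
  obtain ⟨e, he⟩ := hne g
  refine finrank_eq_one_of_units hπ (fun x c => ?_) he
  have : NoZeroDivisors (π.UnitFibre c) :=
    ⟨fun h => ι.eq_zero_or_eq_zero_of_mul_eq_zero hA hab hq c h⟩
  have : Nontrivial (π.UnitFibre c) := nontrivial_of_ne _ _ (hne x).choose_spec
  exact finrank_eq_one_of_noZeroDivisors (B := π.UnitFibre c)

end FellBundle.CompatibleCompletion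

theorem mainTheorem3 {G : Type u} [TopologicalSpace G] [TopologicalGroupoid G] [IsEtaleGroupoid G]
    {E : G → Type v} [∀ g, NormedAddCommGroup (E g)] [∀ g, NormedSpace ℂ (E g)]
    [∀ g, CompleteSpace (E g)] [TopologicalSpace (Tot E)]
    (π : FellBundle E) (hπ : π.IsSaturated)
    {A : Type w} [NonUnitalCStarAlgebra A] (ι : π.CompatibleCompletion A)
    (hA : ι.IsLocalizable) :
    (IsInvolutiveQuantaleHom ι.pStar ∧
        ∀ U : Opens G, IsLocalBisection U → ι.pStar U = ι.restriction U) ∧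
      (π.IsLineBundle ↔ π.IsAbelian ∧ IsQuanticBundle ι.pStar) :=
  ⟨⟨ι.isInvolutiveQuantaleHom_pStar hπ, fun _ hU => ι.pStar_eq_restriction hU⟩,
    fun hL => ⟨hL.isAbelian, ι.isQuanticBundle_of_isLineBundle hπ hA hL⟩,
    fun h => ι.isLineBundle_of_isQuanticBundle hπ hA h.1 h.2⟩
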